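/- Let $\alpha\in(0,1]$, $k>0$, $\sigma_0>0$. For $x\in\mathbb R^3$ write $x'=(x_1,x_2)$. A domain $D\subset\mathbb R^3$ is called uniformly $C^{1,\alpha}$ with constants $k,\sigma_0$ if for every $x_0\in\partial D$ there is an isometry $\mathcal R$ of $\mathbb R^3$ with $\mathcal R(0)=x_0$ such that $$\mathcal R\{\,|x'|<\sigma_0,\ k|x'|^{1+\alpha}<x_3<k\sigma_0^{1+\alpha}\}\subset D,\qquad \mathcal R\{\,|x'|<\sigma_0,\ k|x'|^{1+\alpha}<-x_3<k\sigma_0^{1+\alpha}\}\subset\mathbb R^3\setminus D .$$ Let $\Omega\subset\mathbb R^3$ be a domain and $S\subset\Omega$ a bounded domain, both uniformly $C^{1,\alpha}$ with constants $k,\sigma_0$. Put $h=\operatorname{dist}(S,\partial\Omega)$ and $H=\operatorname{diam}S$, and let $Q\in\partial\Omega$, $P\in\partial S$ realize this distance. Use orthonormal coordinates in which $Q=0$, $P=(0,0,h)$, the plane $x_3=0$ is tangent to $\partial\Omega$ at $Q$, and the positive $x_3$-axis points into $\Omega$ at $Q$. Let $1\le p<\infty$ and let $u\in W^{1,p}_0(\Omega;\mathbb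 R^3)$ (the closure of $C_c^\infty(\Omega;\mathbb R^3)$ in $W^{1,p}$) satisfy $\operatorname{div}u=0$ in $\Omega$ and $u(x)=u_*+\omega\times(x-x_*)$ for a.e. $x\in S$, where $u_*,\omega\in\mathbb R^3$ and $x_*\in\overline S$. Put $u_P=u_*+\omega\times(P-x_*)$, $u_{P\tau}=(u_{P1},u_{P2})$ and $\omega_\tau=(\omega_1,\omega_2)$. For $\sigma>0$ let $$\mathcal C_\sigma=\{\,|x'|<\sigma,\ -k\sigma^{1+\alpha}<x_3<h+2k\sigma^{1+\alpha}\},$$ and let $\|\nabla u\|_{L^p(\mathcal C_\sigma)}$ be computed with $u$ and $\nabla u$ extended by zero outside $\Omega$. Then there is a constant $C_w>0$ depending only on $\alpha,k,\sigma_0$ (in particular not on $p$, $u$, $h$, $\sigma$) such that, if $h\in[0,H]$, then for every $\sigma\in(0,\sigma_0/2]$ $$|u_{P3}|\le C_w\,\sigma^{-1-\frac2p}\,(h+3k\sigma^{1+\alpha})^{2-\frac1p}\,\|\nabla u\|_{L^p(\mathcal C_\sigma)},$$ $$|u_{P\tau}|\le C_w\,\sigma^{-1-\alpha-\frac2p}\,(h+3k\sigma^{1+\alpha})^{2-\frac1p}\,\|\nabla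 u\|_{L^p(\mathcal C_\sigma)},$$ $$|\omega_\tau|\le C_w\,\sigma^{-2-\frac2p}\,(h+3k\sigma^{1+\alpha})^{2-\frac1p}\,\|\nabla u\|_{L^p(\mathcal C_\sigma)},$$ $$|\omega_3|\le C_w\,\sigma^{-2-\alpha-\frac2p}\,(h+3k\sigma^{1+\alpha})^{2-\frac1p}\,\|\nabla u\|_{L^p(\mathcal C_\sigma)}.$$ -/

import Mathlib

open MeasureTheory Filter Topology

/-- Euclidean three-space; the coordinates `x₁, x₂, x₃` of `x` are `x 0, x 1, x 2`. -/
abbrev E3 := EuclideanSpace ℝ (Fin 3)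

/-- `|x'| = |(x₁, x₂)|`, the length of the tangential part of a vector. -/
noncomputable def tangNorm (x : E3) : ℝ := Real.sqrt (x 0 ^ 2 + x 1 ^ 2)

/-- The unit vector of the `i`-th coordinate axis. -/
noncomputable def unitVec (i : Fin 3) : E3 := EuclideanSpace.single i 1

/-- The point `(0, 0, h)`. -/
noncomputable def axisPoint (h : ℝ) : E3 := !₂[0, 0, h]

/-- The vector product `a × b` in Euclidean three-space. -/
noncomputable def cross (a b : E3) : E3 := WithLp.toLp 2 (crossProduct a.ofLp b.ofLp)

/-- The velocity `u_* + ω × (x - x_*)` of a rigid motion. -/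
noncomputable def rigidVelocity (uStar ω xStar x : E3) : E3 := uStar + cross ω (x - xStar)

/-- A domain: a nonempty, connected, open set. -/
def IsDomain3 (D : Set E3) : Prop := IsOpen D ∧ IsConnected D

/-- `D` is a uniformly `C^{1,α}` domain with constants `k`, `σ₀`: at every boundary point `x₀` there
is an isometry `R` with `R 0 = x₀` such that the image of the double region
`k |x'|^{1+α} < |x₃| < k σ₀^{1+α}`, `|x'| < σ₀` does not meet `∂D`, where `D` lies on one side of
its boundary: the upper part (`x₃ > 0`) is mapped into `D`, the lower part (`x₃ < 0`) outside `D`.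
(Both parts being open, neither image meets `∂D`.) -/
def IsUniformlyC1 (α k σ₀ : ℝ) (D : Set E3) : Prop :=
  ∀ x₀ ∈ frontier D, ∃ R : E3 ≃ᵢ E3, R 0 = x₀ ∧
    ∀ x : E3, tangNorm x < σ₀ →
      (k * tangNorm x ^ (1 + α) < x 2 → x 2 < k * σ₀ ^ (1 + α) → R x ∈ D) ∧
      (k * tangNorm x ^ (1 + α) < -x 2 → -x 2 < k * σ₀ ^ (1 + α) → R x ∉ D)

/-- The plane through `x₀` orthogonal to `ν` is tangent to `∂D` at `x₀`, and `ν` points into `D`. -/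
def IsInnerNormal (D : Set E3) (x₀ ν : E3) : Prop :=
  ∀ ε : ℝ, 0 < ε → ∃ δ : ℝ, 0 < δ ∧ ∀ y : E3, ‖y - x₀‖ < δ →
    (ε * ‖y - x₀‖ < inner ℝ (y - x₀) ν → y ∈ D) ∧
    (inner ℝ (y - x₀) ν < -(ε * ‖y - x₀‖) → y ∉ D)

/-- The distance between two sets. -/
noncomputable def setDist (A B : Set E3) : ℝ := sInf (Set.image2 dist A B)

/-- The space of `3 × 3` matrices in which gradients take values, with the Euclidean (Frobenius)
norm; the `i`-th entry is the derivative in direction `x_i`. -/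
abbrev Grad3 := PiLp 2 (fun _ : Fin 3 => E3)

/-- The classical gradient of a vector field. -/
noncomputable def classicalGrad (φ : E3 → E3) (x : E3) : Grad3 :=
  WithLp.toLp 2 (fun i => fderiv ℝ φ x (unitVec i))

/-- `G` is the weak gradient of the vector field `u` in `Ω`. -/
structure HasWeakGrad (Ω : Set E3) (u : E3 → E3) (G : E3 → Grad3) : Prop where
  locInt : LocallyIntegrableOn u Ω volume
  locInt_grad : LocallyIntegrableOn G Ω volume
  integral_eq : ∀ φ : E3 → ℝ, ContDiff ℝ (⊤ : ℕ∞) φ → HasCompactSupport φ → tsupport φ ⊆ Ω →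
    ∀ i : Fin 3, ∫ x in Ω, (fderiv ℝ φ x (unitVec i)) • u x = -∫ x in Ω, φ x • G x i

/-- `u ∈ W₀^{1,p}(Ω)` with weak gradient `G`: `u` belongs to `W^{1,p}(Ω)` and is the limit in
`W^{1,p}(Ω)` of smooth vector fields with compact support in `Ω`. Only the values of `u` and `G` in
`Ω` matter. -/
structure MemW0 (Ω : Set E3) (p : ℝ) (u : E3 → E3) (G : E3 → Grad3) : Prop where
  weakGrad : HasWeakGrad Ω u G
  memLp : MemLp u (ENNReal.ofReal p) (volume.restrict Ω)
  memLp_grad : MemLp G (ENNReal.ofReal p) (volume.restrict Ω)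
  approx : ∃ φ : ℕ → E3 → E3,
    (∀ n, ContDiff ℝ (⊤ : ℕ∞) (φ n) ∧ HasCompactSupport (φ n) ∧ tsupport (φ n) ⊆ Ω) ∧
    Tendsto (fun n => eLpNorm (fun x => φ n x - u x) (ENNReal.ofReal p) (volume.restrict Ω))
      atTop (𝓝 0) ∧
    Tendsto (fun n => eLpNorm (fun x => classicalGrad (φ n) x - G x) (ENNReal.ofReal p)
      (volume.restrict Ω)) atTop (𝓝 0)

/-- `u ∈ W₀^{1,p}(S, Ω)`, with weak gradient `G`, and `u` is in `S` the velocity of the rigid motion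
given by `u_*`, the angular velocity `ω` and the point `x_* ∈ S̄`. -/
structure MemW0Rigid (S Ω : Set E3) (p : ℝ) (u : E3 → E3) (G : E3 → Grad3)
    (uStar ω xStar : E3) : Prop where
  memW0 : MemW0 Ω p u G
  xStar_mem : xStar ∈ closure S
  rigid : ∀ᵐ x ∂(volume.restrict S), u x = rigidVelocity uStar ω xStar x

/-- `div u = 0` in `Ω`, for a field with weak gradient `G`. -/
def DivFree (Ω : Set E3) (G : E3 → Grad3) : Prop :=
  ∀ᵐ x ∂(volume.restrict Ω), ∑ i : Fin 3, (G x i) i = 0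

/-- The cylinder `|x'| < σ`, `-k σ^{1+α} < x₃ < h + 2 k σ^{1+α}`. -/
def nearCylinder (α k h σ : ℝ) : Set E3 :=
  {x | tangNorm x < σ ∧ -(k * σ ^ (1 + α)) < x 2 ∧ x 2 < h + 2 * k * σ ^ (1 + α)}

/-- `‖∇u‖_{L^p(A)}`, where `∇u = G` in `Ω` and `u`, `∇u` are extended by zero outside `Ω`. -/
noncomputable def gradNorm (Ω : Set E3) (p : ℝ) (G : E3 → Grad3) (A : Set E3) : ℝ :=
  (eLpNorm (Ω.indicator G) (ENNReal.ofReal p) (volume.restrict A)).toReal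

/-- The position of the body `S` in the container `Ω` and the choice of coordinates: `h` is the
distance between `S` and `∂Ω`, realized by `Q = 0 ∈ ∂Ω` and `P = (0, 0, h) ∈ ∂S`; the plane
`x₃ = 0` is tangent to `∂Ω` at `Q`, with the `x₃`-axis pointing into `Ω`. -/
structure AdaptedCoordinates (S Ω : Set E3) (h : ℝ) : Prop where
  dist_eq : h = setDist S (frontier Ω)
  Q_mem : (0 : E3) ∈ frontier Ω
  P_mem : axisPoint h ∈ frontier S
  normal : IsInnerNormal Ω 0 (unitVec 2)

/-! Put a = kσ^{1+α} and L = h + 3a. Over the disc |x'| < σ the layer of thickness a below height -a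
lies outside Ω, and the layer of thickness a above height h + a lies in S, where u is rigid
(`LayersSeparated`). Take a vertical profile X supported in [-2a, h + 2a] and affine with slope -1
between the two layers, and horizontal factors f(x₁), g(x₂) living at scale σ. Since X'' vanishes
between the layers and the lower layer misses Ω, ∫ f g X'' u over Ω sees only rigid motion: it is a
moment of an affine field, hence an explicit combination of u_P and ω.

The same integral is controlled by ∇u. One integration by parts in x₃ gives -∫ f g X' ∂₃u with X'
bounded where it matters. For u₃ more is gained: div u = 0 turns ∂₃u₃ into -∂₁u₁ - ∂₂u₂; moving
these derivatives to f and g, and then integrating by parts in x₃ again, leaves ∫ f' g X ∂₃u₁ + ∫ f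
g' X ∂₃u₂, with |X| ≤ L and f', g' of order 1/σ. No boundary terms appear, since u has zero trace
(`MemW0.integral_fderiv_mul`). Hölder on the cylinder, of volume at most 4σ²L, yields
`abs_integral_topWeight_le`.

Even and odd choices of f and g isolate u_{P3}, ω₁, ω₂, ω₃ and the combinations u_{P1} + 2aω₂,
u_{P2} - 2aω₁ (`exists_rigid_bound`). What remains is bookkeeping of powers, using L ≥ 3kσ^{1+α}. -/

/-! ### Local geometry of Ω at Q and of S at P. -/

lemma inner_unitVec_two (x : E3) : inner ℝ x (unitVec 2) = x 2 := by
  simp [unitVec, EuclideanSpace.inner_single_right]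

lemma norm_unitVec (i : Fin 3) : ‖unitVec i‖ = 1 := by
  simp [unitVec]

lemma norm_sq_eq_tangNorm_sq_add (x : E3) : ‖x‖ ^ 2 = tangNorm x ^ 2 + x 2 ^ 2 := by
  rw [EuclideanSpace.norm_sq_eq, Fin.sum_univ_three, tangNorm, Real.sq_sqrt (by positivity)]
  simp

lemma tangNorm_nonneg (x : E3) : 0 ≤ tangNorm x := Real.sqrt_nonneg _

/-- A set with a regular boundary point `x₀` that asymptotically lies above the plane through `x₀`
orthogonal to `e₃` is described near `x₀` in the coordinates with vertical axis `e₃`. -/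
lemma isometry_preserves_vertical {α k σ₀ : ℝ} (hα : 0 < α) (hk : 0 < k) (hσ₀ : 0 < σ₀)
    {D : Set E3} {x₀ : E3} {R : E3 ≃ᵢ E3} (hR0 : R 0 = x₀)
    (hR : ∀ x : E3, tangNorm x < σ₀ → k * tangNorm x ^ (1 + α) < x 2 →
      x 2 < k * σ₀ ^ (1 + α) → R x ∈ D)
    (hD : ∀ ε : ℝ, 0 < ε → ∃ δ : ℝ, 0 < δ ∧ ∀ y : E3, ‖y - x₀‖ < δ →
      inner ℝ (y - x₀) (unitVec 2) < -(ε * ‖y - x₀‖) → y ∉ D) (y : E3) :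
    ∃ x, R x = y ∧ tangNorm x = tangNorm (y - x₀) ∧ x 2 = (y - x₀) 2 := by
  -- By Mazur–Ulam, an isometry fixing the origin is linear.
  let R' : E3 ≃ᵢ E3 := R.trans (IsometryEquiv.subRight x₀)
  have hR'0 : R' 0 = 0 := by simp [R', hR0]
  let L : E3 ≃ₗᵢ[ℝ] E3 := R'.toRealLinearIsometryEquivOfMapZero hR'0
  have hL : ∀ x, L x = R x - x₀ := fun x => rfl
  -- Blow-up: for small t the point t v lies in the upper region, because k|t v'|^{1+α} = o(t), so R
  -- (t v) ∈ D. If L v pointed strictly downwards, this would violate the asymptotic condition with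
  -- half the slope of L v as ε.
  have key : ∀ v : E3, 0 < v 2 → 0 ≤ (L v) 2 := by
    intro v hv
    by_contra! hneg
    have hv0 : 0 < ‖v‖ := norm_pos_iff.2 (by rintro rfl; simp at hv)
    obtain ⟨δ, hδ, H⟩ := hD (-(L v) 2 / (2 * ‖v‖)) (by apply div_pos <;> linarith)
    have e1 : ∀ᶠ t : ℝ in 𝓝[>] 0, t * tangNorm v < σ₀ := by
      have : Tendsto (fun t : ℝ => t * tangNorm v) (𝓝[>] 0) (𝓝 (0 * tangNorm v)) :=
        (Continuous.tendsto (by fun_prop) 0).mono_left nhdsWithin_le_nhds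
      rw [zero_mul] at this
      exact this.eventually_lt_const hσ₀
    have e2 : ∀ᶠ t : ℝ in 𝓝[>] 0, t * v 2 < k * σ₀ ^ (1 + α) := by
      have : Tendsto (fun t : ℝ => t * v 2) (𝓝[>] 0) (𝓝 (0 * v 2)) :=
        (Continuous.tendsto (by fun_prop) 0).mono_left nhdsWithin_le_nhds
      rw [zero_mul] at this
      exact this.eventually_lt_const (by positivity)
    have e3 : ∀ᶠ t : ℝ in 𝓝[>] 0, t * ‖v‖ < δ := by
      have : Tendsto (fun t : ℝ => t * ‖v‖) (𝓝[>] 0) (𝓝 (0 * ‖v‖)) :=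
        (Continuous.tendsto (by fun_prop) 0).mono_left nhdsWithin_le_nhds
      rw [zero_mul] at this
      exact this.eventually_lt_const hδ
    have e4 : ∀ᶠ t : ℝ in 𝓝[>] 0, k * tangNorm v ^ (1 + α) * t ^ α < v 2 := by
      have : Tendsto (fun t : ℝ => k * tangNorm v ^ (1 + α) * t ^ α) (𝓝[>] 0)
          (𝓝 (k * tangNorm v ^ (1 + α) * 0 ^ α)) :=
        (((Real.continuousAt_rpow_const 0 α (Or.inr hα.le)).tendsto).const_mul _).mono_left
          nhdsWithin_le_nhds
      rw [Real.zero_rpow hα.ne', mul_zero] at this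
      exact this.eventually_lt_const hv
    obtain ⟨t, h1, h2, h3, h4, ht⟩ :=
      (e1.and (e2.and (e3.and (e4.and self_mem_nhdsWithin)))).exists
    have ht : 0 < t := ht
    have htn : tangNorm (t • v) = t * tangNorm v := by
      simp only [tangNorm, PiLp.smul_apply, smul_eq_mul]
      rw [show (t * v 0) ^ 2 + (t * v 1) ^ 2 = t ^ 2 * (v 0 ^ 2 + v 1 ^ 2) by ring,
        Real.sqrt_mul (sq_nonneg t), Real.sqrt_sq ht.le]
    have hmem : R (t • v) ∈ D := by
      apply hR
      · rwa [htn]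
      · rw [htn, Real.mul_rpow ht.le (tangNorm_nonneg v), Real.rpow_add ht, Real.rpow_one]
        simp only [PiLp.smul_apply, smul_eq_mul]
        calc k * (t * t ^ α * tangNorm v ^ (1 + α)) = t * (k * tangNorm v ^ (1 + α) * t ^ α) := by
              ring
          _ < t * v 2 := by gcongr
      · simpa using h2
    have hnorm : ‖R (t • v) - x₀‖ = t * ‖v‖ := by
      rw [← hL, L.norm_map, norm_smul, Real.norm_of_nonneg ht.le]
    refine H _ (by rwa [hnorm]) ?_ hmem
    rw [inner_unitVec_two, hnorm, ← hL, map_smul]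
    simp only [PiLp.smul_apply, smul_eq_mul]
    have : -(L v) 2 / (2 * ‖v‖) * (t * ‖v‖) = -(t * (L v) 2) / 2 := by field_simp
    rw [this]
    have : t * (L v) 2 < 0 := mul_neg_of_pos_of_neg ht hneg
    linarith
  have hν : L (unitVec 2) = unitVec 2 := by
    by_contra hne
    set ν := L (unitVec 2) with hνdef
    have hν1 : ‖ν‖ = 1 := by rw [hνdef, L.norm_map, norm_unitVec]
    have hlt : inner ℝ ν (unitVec 2) < 1 := by
      refine lt_of_le_of_ne ?_ ?_
      · simpa [hν1, norm_unitVec] using real_inner_le_norm ν (unitVec 2)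
      · intro h
        exact hne ((inner_eq_one_iff_of_norm_eq_one hν1 (norm_unitVec 2)).1 h)
    have hcomp : ∀ w : E3, (L.symm w) 2 = inner ℝ w ν := by
      intro w
      rw [← inner_unitVec_two, hνdef, ← L.inner_map_map (L.symm w), L.apply_symm_apply]
    -- If ν ≠ e₃, the vector ν - e₃ has positive product with ν and negative product with e₃, so its
    -- preimage points up while it points down.
    have h0 := key (L.symm (ν - unitVec 2)) (by
      rw [hcomp, inner_sub_left, real_inner_self_eq_norm_sq, hν1, real_inner_comm]
      linarith)
    rw [L.apply_symm_apply, ← inner_unitVec_two, inner_sub_left, real_inner_self_eq_norm_sq,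
      norm_unitVec] at h0
    linarith
  refine ⟨L.symm (y - x₀), ?_, ?_⟩
  · have := hL (L.symm (y - x₀))
    rw [L.apply_symm_apply] at this
    exact (sub_left_injective this).symm
  -- L fixes e₃, so it preserves heights; as it also preserves norms, it preserves |x'|.
  · have h2 : (L.symm (y - x₀)) 2 = (y - x₀) 2 := by
      rw [← inner_unitVec_two, ← inner_unitVec_two, ← L.inner_map_map, L.apply_symm_apply, hν]
    refine ⟨?_, h2⟩
    have e1 := norm_sq_eq_tangNorm_sq_add (L.symm (y - x₀))
    have e2 := norm_sq_eq_tangNorm_sq_add (y - x₀)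
    rw [LinearIsometryEquiv.norm_map, e2, h2] at e1
    exact (pow_left_inj₀ (tangNorm_nonneg _) (tangNorm_nonneg _) two_ne_zero).1 (by linarith)

lemma notMem_of_below {α k σ₀ : ℝ} (hα : 0 < α) (hk : 0 < k) (hσ₀ : 0 < σ₀) {S Ω : Set E3} {h : ℝ}
    (hΩ : IsUniformlyC1 α k σ₀ Ω) (hc : AdaptedCoordinates S Ω h) {y : E3}
    (h1 : tangNorm y < σ₀) (h2 : k * tangNorm y ^ (1 + α) < -y 2)
    (h3 : -y 2 < k * σ₀ ^ (1 + α)) : y ∉ Ω := by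
  obtain ⟨R, hR0, hR⟩ := hΩ 0 hc.Q_mem
  obtain ⟨x, hx, htn, hx2⟩ := isometry_preserves_vertical hα hk hσ₀ hR0
    (fun x hx => (hR x hx).1)
    (fun ε hε => (hc.normal ε hε).imp fun δ hδ => ⟨hδ.1, fun y hy => (hδ.2 y hy).2⟩) y
  rw [sub_zero] at htn hx2
  rw [← hx]
  exact (hR x (by rwa [htn])).2 (by rwa [htn, hx2]) (by rwa [hx2])

/-- No tangent plane to ∂S at P is assumed; that S lies asymptotically above the horizontal plane
through P is deduced from P and Q realizing the distance. -/
lemma mem_of_above {α k σ₀ : ℝ} (hα : 0 < α) (hk : 0 < k) (hσ₀ : 0 < σ₀) {S Ω : Set E3} {h : ℝ}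
    (hS : IsUniformlyC1 α k σ₀ S) (hSΩ : S ⊆ Ω) (hh : 0 ≤ h) (hc : AdaptedCoordinates S Ω h)
    {y : E3} (h1 : tangNorm y < σ₀) (h2 : k * tangNorm y ^ (1 + α) < y 2 - h)
    (h3 : y 2 - h < k * σ₀ ^ (1 + α)) : y ∈ S := by
  obtain ⟨R, hR0, hR⟩ := hS _ hc.P_mem
  have hP : ‖axisPoint h‖ = h ∧ axisPoint h 2 = h ∧ axisPoint h 0 = 0 ∧ axisPoint h 1 = 0 := by
    simp [axisPoint, EuclideanSpace.norm_eq, Fin.sum_univ_three, Real.sqrt_sq hh]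
  have hmiss : ∀ ε : ℝ, 0 < ε → ∃ δ : ℝ, 0 < δ ∧ ∀ y : E3, ‖y - axisPoint h‖ < δ →
      inner ℝ (y - axisPoint h) (unitVec 2) < -(ε * ‖y - axisPoint h‖) → y ∉ S := by
    intro ε hε
    -- For h = 0 the points P and Q coincide and S ⊆ Ω inherits the condition at Q. For h > 0, S
    -- avoids the open ball of radius h about Q, whose tangent plane at P is horizontal; expanding
    -- ‖y‖² about P gives δ = 2hε.
    rcases hh.eq_or_lt with rfl | hpos
    · have h0 : axisPoint 0 = 0 := by ext i; fin_cases i <;> simp [axisPoint]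
      obtain ⟨δ, hδ, H⟩ := hc.normal ε hε
      rw [h0]
      exact ⟨δ, hδ, fun y hy hy2 hyS => (H y hy).2 hy2 (hSΩ hyS)⟩
    · refine ⟨2 * h * ε, by positivity, fun y hy hy2 hyS => ?_⟩
      have hle : h ≤ ‖y‖ := by
        conv_lhs => rw [hc.dist_eq]
        refine csInf_le ⟨0, ?_⟩ ⟨y, hyS, 0, hc.Q_mem, dist_zero_right y⟩
        rintro _ ⟨a, -, b, -, rfl⟩
        exact dist_nonneg
      have e : ‖y‖ ^ 2 = ‖y - axisPoint h‖ ^ 2 + 2 * h * (y - axisPoint h) 2 + h ^ 2 := by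
        simp only [EuclideanSpace.norm_sq_eq, Fin.sum_univ_three, PiLp.sub_apply, hP,
          Real.norm_eq_abs, sq_abs]
        ring
      rw [inner_unitVec_two] at hy2
      have : ‖y - axisPoint h‖ ≠ 0 := by
        intro h0
        rw [norm_eq_zero] at h0
        simp [h0] at hy2
      have hn : 0 < ‖y - axisPoint h‖ := lt_of_le_of_ne (norm_nonneg _) this.symm
      nlinarith [mul_lt_mul_of_pos_left hy hn, mul_lt_mul_of_pos_left hy2 hpos]
  obtain ⟨x, hx, htn, hx2⟩ := isometry_preserves_vertical hα hk hσ₀ hR0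
    (fun x hx => (hR x hx).1) hmiss y
  have htn' : tangNorm (y - axisPoint h) = tangNorm y := by simp [tangNorm, hP]
  have hy2 : (y - axisPoint h) 2 = y 2 - h := by simp [hP]
  rw [htn'] at htn
  rw [hy2] at hx2
  rw [← hx]
  exact (hR x (by rwa [htn])).1 (by rwa [htn, hx2]) (by rwa [hx2])

/-! ### Hölder estimates and testing of functions with zero trace. -/

/-- Hölder's inequality for a bounded weight that vanishes outside `A`. -/
lemma enorm_setIntegral_mul_le {E : Type*} [NormedAddCommGroup E] {Ω A : Set E3} {p : ℝ}
    (hΩ : MeasurableSet Ω) (hA : MeasurableSet A) (hp : 1 ≤ p) {F : E3 → E}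
    (hF : AEStronglyMeasurable F (volume.restrict Ω)) {g Φ : E3 → ℝ} {M : ℝ}
    (hg : ∀ x, |g x| ≤ ‖F x‖) (hM : ∀ x ∈ Ω, x ∈ A → |Φ x| ≤ M)
    (h0 : ∀ x ∈ Ω, x ∉ A → Φ x = 0) :
    ‖∫ x in Ω, Φ x * g x‖ₑ ≤ ENNReal.ofReal M *
      (eLpNorm (Ω.indicator F) (ENNReal.ofReal p) (volume.restrict A) *
        volume A ^ (1 - 1 / p)) := by
  have h1 : eLpNorm (Ω.indicator F) 1 (volume.restrict A) ≤
      eLpNorm (Ω.indicator F) (ENNReal.ofReal p) (volume.restrict A) *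
        volume A ^ (1 - 1 / p) := by
    have hm : AEStronglyMeasurable (Ω.indicator F) (volume.restrict A) :=
      ((aestronglyMeasurable_indicator_iff hΩ).2 hF).restrict
    have := eLpNorm_le_eLpNorm_mul_rpow_measure_univ (p := 1) (q := ENNReal.ofReal p)
      (by simpa using hp) hm
    simpa [ENNReal.toReal_ofReal (zero_le_one.trans hp)] using this
  calc ‖∫ x in Ω, Φ x * g x‖ₑ ≤ ∫⁻ x in Ω, ‖Φ x * g x‖ₑ := enorm_integral_le_lintegral_enorm _
    _ = ∫⁻ x, Ω.indicator (fun x => ‖Φ x * g x‖ₑ) x := (lintegral_indicator hΩ _).symm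
    _ ≤ ∫⁻ x, A.indicator (fun x => ENNReal.ofReal M * ‖Ω.indicator F x‖ₑ) x := by
        refine lintegral_mono fun x => ?_
        by_cases hx : x ∈ Ω
        · by_cases hxA : x ∈ A
          · simp only [hx, hxA, Set.indicator_of_mem, enorm_mul]
            gcongr
            · rw [Real.enorm_eq_ofReal_abs]
              exact ENNReal.ofReal_le_ofReal (hM x hx hxA)
            · rw [enorm_le_iff_norm_le]
              exact hg x
          · rw [Set.indicator_of_mem hx]
            simp [h0 x hx hxA]
        · simp [hx]
    _ = ∫⁻ x in A, ENNReal.ofReal M * ‖Ω.indicator F x‖ₑ := lintegral_indicator hA _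
    _ = ENNReal.ofReal M * eLpNorm (Ω.indicator F) 1 (volume.restrict A) := by
        rw [lintegral_const_mul' _ _ ENNReal.ofReal_ne_top, eLpNorm_one_eq_lintegral_enorm]
    _ ≤ _ := by gcongr

lemma integrableOn_mul_of_memLp {Ω : Set E3} {p : ℝ} (hp : 1 ≤ p) {g : E3 → ℝ}
    (hg : MemLp g (ENNReal.ofReal p) (volume.restrict Ω)) {Φ : E3 → ℝ} (hΦ : Continuous Φ)
    (hc : HasCompactSupport Φ) : IntegrableOn (fun x => Φ x * g x) Ω := by
  have := hg.locallyIntegrable (by simpa using hp)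
  exact this.integrable_smul_left_of_hasCompactSupport hΦ hc

/-- A bounded weight with compact support defines a continuous functional on L^p, by Hölder on its
support. This passes the integration by parts from smooth approximants to u. -/
lemma tendsto_setIntegral_mul {E : Type*} [NormedAddCommGroup E] {Ω : Set E3} {p : ℝ}
    (hΩ : MeasurableSet Ω) (hp : 1 ≤ p) {F : ℕ → E3 → E}
    (hF : ∀ n, AEStronglyMeasurable (F n) (volume.restrict Ω))
    (hlim : Tendsto (fun n => eLpNorm (F n) (ENNReal.ofReal p) (volume.restrict Ω)) atTop (𝓝 0))
    {f : ℕ → E3 → ℝ} {g Φ : E3 → ℝ} (hfg : ∀ n x, |f n x - g x| ≤ ‖F n x‖)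
    (hΦ : Continuous Φ) (hc : HasCompactSupport Φ)
    (hfi : ∀ n, IntegrableOn (fun x => Φ x * f n x) Ω)
    (hgi : IntegrableOn (fun x => Φ x * g x) Ω) :
    Tendsto (fun n => ∫ x in Ω, Φ x * f n x) atTop (𝓝 (∫ x in Ω, Φ x * g x)) := by
  obtain ⟨M, hM⟩ := hΦ.bounded_above_of_compact_support hc
  set A := tsupport Φ with hA
  have hAm : MeasurableSet A := (isClosed_tsupport _).measurableSet
  have hAfin : volume A ^ (1 - 1 / p) ≠ ⊤ :=
    ENNReal.rpow_ne_top_of_nonneg (by rw [sub_nonneg, div_le_one (by linarith)]; exact hp)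
      hc.isCompact.measure_lt_top.ne
  rw [tendsto_iff_edist_tendsto_0]
  have hb : Tendsto (fun n => ENNReal.ofReal M *
      (eLpNorm (F n) (ENNReal.ofReal p) (volume.restrict Ω) * volume A ^ (1 - 1 / p)))
      atTop (𝓝 0) := by
    have h1 := ENNReal.Tendsto.mul_const (b := volume A ^ (1 - 1 / p)) hlim (Or.inr hAfin)
    have h2 := ENNReal.Tendsto.const_mul (a := ENNReal.ofReal M) h1 (Or.inr ENNReal.ofReal_ne_top)
    simpa using h2
  refine tendsto_of_tendsto_of_tendsto_of_le_of_le tendsto_const_nhds hb (fun _ => zero_le)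
    fun n => ?_
  rw [edist_eq_enorm_sub, ← integral_sub (hfi n) hgi]
  simp only [← mul_sub]
  refine (enorm_setIntegral_mul_le hΩ hAm hp (hF n) (M := M) (hfg n)
    (fun x _ _ => hM x) (fun x _ hx => image_eq_zero_of_notMem_tsupport hx)).trans ?_
  gcongr
  rw [← eLpNorm_indicator_eq_eLpNorm_restrict hΩ]
  exact eLpNorm_mono_measure _ Measure.restrict_le_self

lemma MemLp.component {Ω : Set E3} {q : ENNReal} {u : E3 → E3}
    (hu : MemLp u q (volume.restrict Ω)) (j : Fin 3) :
    MemLp (fun x => u x j) q (volume.restrict Ω) :=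
  (EuclideanSpace.proj (𝕜 := ℝ) (ι := Fin 3) j).comp_memLp' hu

lemma MemLp.gradComponent {Ω : Set E3} {q : ENNReal} {G : E3 → Grad3}
    (hG : MemLp G q (volume.restrict Ω)) (i j : Fin 3) :
    MemLp (fun x => G x i j) q (volume.restrict Ω) :=
  MemLp.component ((PiLp.proj (𝕜 := ℝ) 2 (fun _ : Fin 3 => E3) i).comp_memLp' hG) j

lemma fderiv_component {φ : E3 → E3} {x : E3} (hφ : DifferentiableAt ℝ φ x) (j : Fin 3) (v : E3) :
    fderiv ℝ (fun x => φ x j) x v = (fderiv ℝ φ x v) j := by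
  have hd := (EuclideanSpace.proj (𝕜 := ℝ) (ι := Fin 3) j).hasFDerivAt.comp x hφ.hasFDerivAt
  exact congrArg (fun L : E3 →L[ℝ] ℝ => L v) hd.fderiv

lemma classicalGrad_apply (φ : E3 → E3) (x : E3) (i j : Fin 3) :
    classicalGrad φ x i j = (fderiv ℝ φ x (unitVec i)) j := rfl

lemma continuous_classicalGrad {φ : E3 → E3} (hφ : ContDiff ℝ (⊤ : ℕ∞) φ) :
    Continuous (classicalGrad φ) := by
  refine (PiLp.continuous_toLp 2 _).comp (continuous_pi fun i => ?_)
  exact (hφ.continuous_fderiv (by simp)).clm_apply continuous_const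

lemma continuous_gradComponent {φ : E3 → E3} (hφ : ContDiff ℝ (⊤ : ℕ∞) φ) (i j : Fin 3) :
    Continuous fun x => classicalGrad φ x i j := by
  simp only [classicalGrad_apply]
  have := (hφ.continuous_fderiv (by simp)).clm_apply (continuous_const (y := unitVec i))
  fun_prop

/-- For a function in `W₀^{1,p}`, the weak derivative may be tested against all smooth functions with
compact support in the whole space. -/
lemma MemW0.integral_fderiv_mul {Ω : Set E3} {p : ℝ} (hΩ : IsOpen Ω) (hp : 1 ≤ p) {u : E3 → E3}
    {G : E3 → Grad3} (hu : MemW0 Ω p u G) {Ψ : E3 → ℝ} (hΨ : ContDiff ℝ (⊤ : ℕ∞) Ψ)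
    (hc : HasCompactSupport Ψ) (i j : Fin 3) :
    ∫ x in Ω, fderiv ℝ Ψ x (unitVec i) * u x j = -∫ x in Ω, Ψ x * G x i j := by
  obtain ⟨φ, hφ, hlim, hlimG⟩ := hu.approx
  have hdΨ : Continuous fun x => fderiv ℝ Ψ x (unitVec i) :=
    (hΨ.continuous_fderiv (by simp)).clm_apply continuous_const
  have hdc : HasCompactSupport fun x => fderiv ℝ Ψ x (unitVec i) := hc.fderiv_apply ℝ _
  have hφc : ∀ n, Continuous fun x => φ n x j := fun n => by
    have := (hφ n).1.continuous
    fun_prop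
  have hgrad : ∀ n, Continuous (classicalGrad (φ n)) := fun n => continuous_classicalGrad (hφ n).1
  have hgc : ∀ n, Continuous fun x => classicalGrad (φ n) x i j := fun n =>
    continuous_gradComponent (hφ n).1 i j
  have hcomp : ∀ n x, fderiv ℝ (fun x => φ n x j) x (unitVec i) = classicalGrad (φ n) x i j :=
    fun n x => (fderiv_component ((hφ n).1.differentiable (by simp) x) j _).trans
      (classicalGrad_apply (φ n) x i j).symm
  have h1 := tendsto_setIntegral_mul hΩ.measurableSet hp
    (fun n => ((hφ n).1.continuous.aestronglyMeasurable.sub hu.memLp.1)) hlim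
    (f := fun n x => φ n x j) (g := fun x => u x j)
    (fun n x => PiLp.norm_apply_le (φ n x - u x) j) hdΨ hdc
    (fun n => ((hdΨ.mul (hφc n)).integrable_of_hasCompactSupport hdc.mul_right).integrableOn)
    (integrableOn_mul_of_memLp hp (MemLp.component hu.memLp j) hdΨ hdc)
  have h2 := tendsto_setIntegral_mul hΩ.measurableSet hp
    (fun n => ((hgrad n).aestronglyMeasurable.sub hu.memLp_grad.1)) hlimG
    (f := fun n x => classicalGrad (φ n) x i j) (g := fun x => G x i j)
    (fun n x => (PiLp.norm_apply_le ((classicalGrad (φ n) x - G x) i) j).trans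
      (PiLp.norm_apply_le (classicalGrad (φ n) x - G x) i)) hΨ.continuous hc
    (fun n => ((hΨ.continuous.mul (hgc n)).integrable_of_hasCompactSupport
      hc.mul_right).integrableOn)
    (integrableOn_mul_of_memLp hp (MemLp.gradComponent hu.memLp_grad i j) hΨ.continuous hc)
  refine tendsto_nhds_unique h1 ((h2.neg).congr fun n => ?_)
  have hzero : ∀ x ∉ Ω, φ n x = 0 := fun x hx =>
    image_eq_zero_of_notMem_tsupport fun h => hx ((hφ n).2.2 h)
  have hzero' : ∀ x ∉ Ω, classicalGrad (φ n) x i j = 0 := fun x hx => by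
    have : fderiv ℝ (φ n) x = 0 :=
      image_eq_zero_of_notMem_tsupport fun h => hx ((hφ n).2.2 (tsupport_fderiv_subset ℝ h))
    simp [classicalGrad, this]
  -- The approximants vanish outside Ω, so both integrals extend to the whole space, where
  -- integration by parts has no boundary term.
  rw [setIntegral_eq_integral_of_forall_compl_eq_zero (fun x hx => by simp [hzero' x hx]),
    setIntegral_eq_integral_of_forall_compl_eq_zero (fun x hx => by simp [hzero x hx])]
  have hφd : ContDiff ℝ (⊤ : ℕ∞) fun x => φ n x j :=
    (EuclideanSpace.proj (𝕜 := ℝ) (ι := Fin 3) j).contDiff.comp (hφ n).1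
  have := integral_mul_fderiv_eq_neg_fderiv_mul_of_integrable (μ := (volume : Measure E3))
    (f := Ψ) (g := fun x => φ n x j) (v := unitVec i)
    ((hdΨ.mul (hφc n)).integrable_of_hasCompactSupport hdc.mul_right)
    (by
      simp only [hcomp]
      exact (hΨ.continuous.mul (hgc n)).integrable_of_hasCompactSupport hc.mul_right)
    ((hΨ.continuous.mul (hφc n)).integrable_of_hasCompactSupport hc.mul_right)
    (fun x _ => hΨ.differentiable (by simp) x) (fun x _ => hφd.differentiable (by simp) x)
  simp only [hcomp] at this
  rw [this, neg_neg]

/-! ### Product test functions. -/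

/-- The product `f(x₁) g(x₂) w(x₃)`. -/
def tens (f g w : ℝ → ℝ) (x : E3) : ℝ := f (x 0) * g (x 1) * w (x 2)

lemma tens_contDiff {f g w : ℝ → ℝ} (hf : ContDiff ℝ (⊤ : ℕ∞) f) (hg : ContDiff ℝ (⊤ : ℕ∞) g)
    (hw : ContDiff ℝ (⊤ : ℕ∞) w) : ContDiff ℝ (⊤ : ℕ∞) (tens f g w) := by
  have hp : ∀ i : Fin 3, ContDiff ℝ (⊤ : ℕ∞) fun x : E3 => x i := fun i =>
    (EuclideanSpace.proj (𝕜 := ℝ) (ι := Fin 3) i).contDiff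
  exact ((hf.comp (hp 0)).mul (hg.comp (hp 1))).mul (hw.comp (hp 2))

lemma tens_hasCompactSupport {f g w : ℝ → ℝ} (hf : HasCompactSupport f) (hg : HasCompactSupport g)
    (hw : HasCompactSupport w) : HasCompactSupport (tens f g w) := by
  let e := (EuclideanSpace.equiv (Fin 3) ℝ).toHomeomorph
  have hK : IsCompact (Set.univ.pi ![tsupport f, tsupport g, tsupport w]) :=
    isCompact_univ_pi fun i => by
      fin_cases i
      exacts [hf.isCompact, hg.isCompact, hw.isCompact]
  refine HasCompactSupport.intro ((e.isCompact_preimage).2 hK) fun x hx => ?_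
  by_contra hne
  apply hx
  have hne' : f (x 0) * g (x 1) * w (x 2) ≠ 0 := hne
  simp only [ne_eq, mul_eq_zero, not_or] at hne'
  intro i _
  fin_cases i
  exacts [subset_tsupport _ hne'.1.1, subset_tsupport _ hne'.1.2, subset_tsupport _ hne'.2]

lemma fderiv_tens {f g w : ℝ → ℝ} (hf : ContDiff ℝ (⊤ : ℕ∞) f) (hg : ContDiff ℝ (⊤ : ℕ∞) g)
    (hw : ContDiff ℝ (⊤ : ℕ∞) w) (x : E3) :
    fderiv ℝ (tens f g w) x (unitVec 0) = tens (deriv f) g w x ∧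
    fderiv ℝ (tens f g w) x (unitVec 1) = tens f (deriv g) w x ∧
    fderiv ℝ (tens f g w) x (unitVec 2) = tens f g (deriv w) x := by
  have hp : ∀ (i : Fin 3) {q : ℝ → ℝ}, ContDiff ℝ (⊤ : ℕ∞) q →
      HasFDerivAt (fun x : E3 => q (x i)) (deriv q (x i) • EuclideanSpace.proj (𝕜 := ℝ) i) x :=
    fun i q hq => ((hq.differentiable (by simp) _).hasDerivAt).comp_hasFDerivAt x
      (EuclideanSpace.proj (𝕜 := ℝ) (ι := Fin 3) i).hasFDerivAt
  have h : HasFDerivAt (tens f g w) _ x := ((hp 0 hf).mul (hp 1 hg)).mul (hp 2 hw)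
  rw [h.fderiv]
  refine ⟨?_, ?_, ?_⟩ <;> simp [unitVec, tens] <;> ring

section Product

variable {f g w : ℝ → ℝ}

lemma integral_tens (f g w : ℝ → ℝ) :
    ∫ x, tens f g w x = (∫ t, f t) * (∫ t, g t) * ∫ t, w t := by
  have h := integral_fintype_prod_volume_eq_prod (𝕜 := ℝ) (ι := Fin 3) (E := fun _ => ℝ)
    ![f, g, w]
  rw [← (EuclideanSpace.volume_preserving_symm_measurableEquiv_toLp (Fin 3)).integral_comp'] at h
  simpa [Fin.prod_univ_three, tens] using h

lemma integrable_tens (hf : Integrable f) (hg : Integrable g) (hw : Integrable w) :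
    Integrable (tens f g w) := by
  have h : Integrable (fun x : Fin 3 → ℝ => ∏ i, ![f, g, w] i (x i)) :=
    Integrable.fintype_prod (f := ![f, g, w]) fun i => by fin_cases i <;> assumption
  rw [← (EuclideanSpace.volume_preserving_symm_measurableEquiv_toLp
    (Fin 3)).integrable_comp_emb (MeasurableEquiv.measurableEmbedding _)] at h
  refine h.congr (ae_of_all _ fun x => ?_)
  simp [Fin.prod_univ_three, tens]

end Product

/-! ### The vertical profile and its moments. -/

/-- A smooth function that vanishes for `s ≤ 0` and equals `s` for `s ≥ 1/2`. -/
noncomputable def smoothRamp (s : ℝ) : ℝ := s * Real.smoothTransition (2 * s)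

lemma smoothRamp_contDiff : ContDiff ℝ (⊤ : ℕ∞) smoothRamp :=
  contDiff_id.mul (Real.smoothTransition.contDiff.comp (contDiff_const.mul contDiff_id))

lemma smoothRamp_of_nonpos {s : ℝ} (hs : s ≤ 0) : smoothRamp s = 0 := by
  rw [smoothRamp, Real.smoothTransition.zero_of_nonpos (by linarith), mul_zero]

lemma smoothRamp_of_half_le {s : ℝ} (hs : 1 / 2 ≤ s) : smoothRamp s = s := by
  rw [smoothRamp, Real.smoothTransition.one_of_one_le (by linarith), mul_one]

lemma smoothRamp_abs_le {s : ℝ} (hs : 0 ≤ s) : |smoothRamp s| ≤ s := by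
  rw [smoothRamp, abs_mul, abs_of_nonneg hs, abs_of_nonneg (Real.smoothTransition.nonneg _)]
  exact mul_le_of_le_one_right hs (Real.smoothTransition.le_one _)

lemma deriv_smoothRamp_of_half_lt {s : ℝ} (hs : 1 / 2 < s) : deriv smoothRamp s = 1 := by
  have : smoothRamp =ᶠ[𝓝 s] id := by
    filter_upwards [lt_mem_nhds hs] with t ht using smoothRamp_of_half_le ht.le
  rw [this.deriv_eq, deriv_id]

lemma exists_deriv_smoothRamp_bound : ∃ c : ℝ, 0 < c ∧ ∀ s, |deriv smoothRamp s| ≤ c := by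
  obtain ⟨c, hc⟩ := isCompact_Icc.exists_bound_of_continuousOn (s := Set.Icc (0 : ℝ) 1)
    ((smoothRamp_contDiff.continuous_deriv (by simp)).continuousOn)
  refine ⟨max c 1, by positivity, fun s => ?_⟩
  rcases lt_or_ge s 0 with hs | hs
  · have : smoothRamp =ᶠ[𝓝 s] fun _ => 0 := by
      filter_upwards [gt_mem_nhds hs] with t ht using smoothRamp_of_nonpos ht.le
    rw [this.deriv_eq, deriv_const, abs_zero]
    positivity
  · rcases le_or_gt s 1 with hs1 | hs1
    · exact (hc s ⟨hs, hs1⟩).trans (le_max_left _ _)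
    · rw [deriv_smoothRamp_of_half_lt (by linarith), abs_one]
      exact le_max_right _ _

/-- The vertical profile of the test functions: it vanishes outside `[-2a, h + 2a]` and equals
`h + 2a - t` for `-a ≤ t ≤ h + a`. -/
noncomputable def vertProfile (a h t : ℝ) : ℝ :=
  Real.smoothTransition (2 * ((t + 2 * a) / a)) * (a * smoothRamp ((h + 2 * a - t) / a))

section vertProfile

variable {a h : ℝ}

lemma vertProfile_contDiff : ContDiff ℝ (⊤ : ℕ∞) (vertProfile a h) := by
  refine ContDiff.mul (Real.smoothTransition.contDiff.comp ?_)
    (contDiff_const.mul (smoothRamp_contDiff.comp ?_)) <;> fun_prop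

lemma vertProfile_eq_zero (ha : 0 < a) {t : ℝ} (ht : t ∉ Set.Icc (-2 * a) (h + 2 * a)) :
    vertProfile a h t = 0 := by
  rw [Set.mem_Icc, not_and_or, not_le, not_le] at ht
  rcases ht with ht | ht
  · rw [vertProfile, Real.smoothTransition.zero_of_nonpos, zero_mul]
    have : (t + 2 * a) / a ≤ 0 := div_nonpos_of_nonpos_of_nonneg (by linarith) ha.le
    linarith
  · rw [vertProfile, smoothRamp_of_nonpos, mul_zero, mul_zero]
    exact div_nonpos_of_nonpos_of_nonneg (by linarith) ha.le

/-- Continuity removes the endpoints. This is needed because the cylinder is open at height h + 2a.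
-/
lemma eq_zero_of_notMem_Ioo {F : ℝ → ℝ} {b c : ℝ} (hF : Continuous F)
    (h0 : ∀ t ∉ Set.Icc b c, F t = 0) {t : ℝ} (ht : t ∉ Set.Ioo b c) : F t = 0 := by
  have h1 : closure (Set.Icc b c)ᶜ ⊆ {t | F t = 0} :=
    closure_minimal h0 (isClosed_eq hF continuous_const)
  rw [closure_compl, interior_Icc] at h1
  exact h1 ht

lemma vertProfile_hasCompactSupport (ha : 0 < a) : HasCompactSupport (vertProfile a h) :=
  HasCompactSupport.intro isCompact_Icc fun _ ht => vertProfile_eq_zero ha ht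

lemma vertProfile_tsupport (ha : 0 < a) :
    tsupport (vertProfile a h) ⊆ Set.Icc (-2 * a) (h + 2 * a) :=
  closure_minimal (fun _ ht => by_contra fun h' => ht (vertProfile_eq_zero ha h')) isClosed_Icc

lemma vertProfile_deriv_eq_zero (ha : 0 < a) {t : ℝ} (ht : t ∉ Set.Icc (-2 * a) (h + 2 * a)) :
    deriv (vertProfile a h) t = 0 :=
  image_eq_zero_of_notMem_tsupport fun h' =>
    ht (vertProfile_tsupport ha (tsupport_deriv_subset (𝕜 := ℝ) h'))

lemma vertProfile_deriv_deriv_eq_zero (ha : 0 < a) {t : ℝ}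
    (ht : t ∉ Set.Icc (-2 * a) (h + 2 * a)) : deriv (deriv (vertProfile a h)) t = 0 :=
  image_eq_zero_of_notMem_tsupport fun h' => ht (vertProfile_tsupport ha
    (tsupport_deriv_subset (𝕜 := ℝ) (tsupport_deriv_subset (𝕜 := ℝ) h')))

lemma vertProfile_of_ge (ha : 0 < a) {t : ℝ} (ht : -(3 / 2 * a) ≤ t) :
    vertProfile a h t = a * smoothRamp ((h + 2 * a - t) / a) := by
  rw [vertProfile, Real.smoothTransition.one_of_one_le, one_mul]
  have : 1 / 2 ≤ (t + 2 * a) / a := by rw [le_div_iff₀ ha]; linarith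
  linarith

/-- The margin a/2 beyond [-a, h + a] lets derivatives be computed at the level h + a itself. -/
lemma vertProfile_eq (ha : 0 < a) {t : ℝ} (ht : t ∈ Set.Icc (-(3 / 2 * a)) (h + 3 / 2 * a)) :
    vertProfile a h t = h + 2 * a - t := by
  rw [vertProfile_of_ge ha ht.1, smoothRamp_of_half_le]
  · field_simp
  · rw [le_div_iff₀ ha]; linarith [ht.2]

lemma vertProfile_deriv_eq (ha : 0 < a) {t : ℝ}
    (ht : t ∈ Set.Ioo (-(3 / 2 * a)) (h + 3 / 2 * a)) : deriv (vertProfile a h) t = -1 := by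
  have : vertProfile a h =ᶠ[𝓝 t] fun t => h + 2 * a - t := by
    filter_upwards [Ioo_mem_nhds ht.1 ht.2] with s hs using
      vertProfile_eq ha (Set.Ioo_subset_Icc_self hs)
  rw [this.deriv_eq]
  simp

lemma vertProfile_deriv_deriv_eq (ha : 0 < a) {t : ℝ}
    (ht : t ∈ Set.Ioo (-(3 / 2 * a)) (h + 3 / 2 * a)) :
    deriv (deriv (vertProfile a h)) t = 0 := by
  have : deriv (vertProfile a h) =ᶠ[𝓝 t] fun _ => -1 := by
    filter_upwards [Ioo_mem_nhds ht.1 ht.2] with s hs using vertProfile_deriv_eq ha hs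
  rw [this.deriv_eq, deriv_const]

lemma vertProfile_abs_le (ha : 0 < a) (hh : 0 ≤ h) {t : ℝ} (ht : -a ≤ t) :
    |vertProfile a h t| ≤ h + 3 * a := by
  rcases le_or_gt t (h + 2 * a) with h1 | h1
  · rw [vertProfile_of_ge ha (by linarith), abs_mul, abs_of_pos ha]
    have := smoothRamp_abs_le (s := (h + 2 * a - t) / a) (div_nonneg (by linarith) ha.le)
    calc a * |smoothRamp ((h + 2 * a - t) / a)| ≤ a * ((h + 2 * a - t) / a) := by gcongr
      _ = h + 2 * a - t := by field_simp
      _ ≤ _ := by linarith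
  · rw [vertProfile_eq_zero ha (fun h' => by linarith [h'.2]), abs_zero]
    positivity

/-- The factors a and 1/a cancel, so the bound depends neither on a nor on h. Below -a, where the
lower cut-off acts, no bound is required, since Ω is absent from that layer. -/
lemma vertProfile_deriv_abs_le (ha : 0 < a) {c : ℝ} (hc : ∀ s, |deriv smoothRamp s| ≤ c) {t : ℝ}
    (ht : -a ≤ t) : |deriv (vertProfile a h) t| ≤ c := by
  have h1 : vertProfile a h =ᶠ[𝓝 t] fun t => a * smoothRamp ((h + 2 * a - t) / a) := by
    filter_upwards [lt_mem_nhds (show -(3 / 2 * a) < t by linarith)] with s hs using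
      vertProfile_of_ge ha hs.le
  have h2 : HasDerivAt (fun t => a * smoothRamp ((h + 2 * a - t) / a))
      (a * (deriv smoothRamp ((h + 2 * a - t) / a) * (-1 / a))) t :=
    (((smoothRamp_contDiff.differentiable (by simp) _).hasDerivAt).comp t
      (((hasDerivAt_id t).const_sub (h + 2 * a)).div_const a)).const_mul a
  rw [h1.deriv_eq, h2.deriv]
  have : a * (deriv smoothRamp ((h + 2 * a - t) / a) * (-1 / a)) =
      -deriv smoothRamp ((h + 2 * a - t) / a) := by field_simp
  rw [this, abs_neg]
  exact hc _

lemma vertProfile_deriv_contDiff : ContDiff ℝ (⊤ : ℕ∞) (deriv (vertProfile a h)) :=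
  (contDiff_infty_iff_deriv.1 vertProfile_contDiff).2

lemma vertProfile_deriv_deriv_contDiff :
    ContDiff ℝ (⊤ : ℕ∞) (deriv (deriv (vertProfile a h))) :=
  (contDiff_infty_iff_deriv.1 vertProfile_deriv_contDiff).2

/-- The second derivative of the profile in the layer above `h + a`. -/
noncomputable def topWeight (a h : ℝ) : ℝ → ℝ :=
  (Set.Ioi (h + a)).indicator (deriv (deriv (vertProfile a h)))

lemma topWeight_integrable (ha : 0 < a) : Integrable (topWeight a h) :=
  ((vertProfile_deriv_deriv_contDiff.continuous).integrable_of_hasCompactSupport (μ := volume)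
    (vertProfile_hasCompactSupport ha).deriv.deriv).indicator measurableSet_Ioi

lemma topWeight_mul_integrable (ha : 0 < a) :
    Integrable (fun t => topWeight a h t * (t - h)) := by
  have h1 : Continuous fun t => deriv (deriv (vertProfile a h)) t * (t - h) :=
    vertProfile_deriv_deriv_contDiff.continuous.mul (by fun_prop)
  have h2 := (h1.integrable_of_hasCompactSupport (μ := volume)
    (vertProfile_hasCompactSupport ha).deriv.deriv.mul_right).indicator
      (measurableSet_Ioi (a := h + a))
  refine h2.congr (ae_of_all _ fun t => ?_)
  by_cases ht : t ∈ Set.Ioi (h + a) <;> simp [topWeight, ht]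

/-- The slope of the profile rises from -1 at h + a to 0 beyond the support. -/
lemma integral_topWeight (ha : 0 < a) (hh : 0 ≤ h) : ∫ t, topWeight a h t = 1 := by
  rw [topWeight, integral_indicator measurableSet_Ioi,
    (vertProfile_hasCompactSupport ha).deriv.integral_Ioi_deriv_eq
      (vertProfile_deriv_contDiff.of_le (by simp)),
    vertProfile_deriv_eq ha ⟨by linarith, by linarith⟩, neg_neg]

lemma integral_topWeight_mul (ha : 0 < a) (hh : 0 ≤ h) :
    ∫ t, topWeight a h t * (t - h) = 2 * a := by
  -- With X the profile, F is an antiderivative of X''(t)(t - h), and F(h + a) = -a - a.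
  set F : ℝ → ℝ := fun t => deriv (vertProfile a h) t * (t - h) - vertProfile a h t with hF
  have hFd : deriv F = fun t => deriv (deriv (vertProfile a h)) t * (t - h) := by
    ext t
    have h1 := (vertProfile_deriv_contDiff (a := a) (h := h)).differentiable (by simp) t
    have h2 := (vertProfile_contDiff (a := a) (h := h)).differentiable (by simp) t
    have h3 := (h1.hasDerivAt.mul ((hasDerivAt_id t).sub_const h)).sub h2.hasDerivAt
    refine h3.deriv.trans ?_
    simp
  have hFc : HasCompactSupport F :=
    (vertProfile_hasCompactSupport ha).deriv.mul_right.sub (vertProfile_hasCompactSupport ha)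
  have hFs : ContDiff ℝ 1 F :=
    ((vertProfile_deriv_contDiff.of_le (by simp)).mul (by fun_prop)).sub
      (vertProfile_contDiff.of_le (by simp))
  have h1 : (fun t => topWeight a h t * (t - h)) = (Set.Ioi (h + a)).indicator (deriv F) := by
    ext t
    by_cases ht : t ∈ Set.Ioi (h + a) <;> simp [topWeight, ht, hFd]
  rw [h1, integral_indicator measurableSet_Ioi, hFc.integral_Ioi_deriv_eq hFs, hF]
  simp only
  rw [vertProfile_deriv_eq ha ⟨by linarith, by linarith⟩,
    vertProfile_eq ha ⟨by linarith, by linarith⟩]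
  ring

end vertProfile

lemma integral_tens_topWeight_mul_affine {a h : ℝ} (ha : 0 < a) (hh : 0 ≤ h) {f g : ℝ → ℝ}
    (hf : Continuous f) (hfc : HasCompactSupport f) (hg : Continuous g) (hgc : HasCompactSupport g)
    (c β₀ β₁ β₂ : ℝ) :
    ∫ x, tens f g (topWeight a h) x * (c + β₀ * x 0 + β₁ * x 1 + β₂ * (x 2 - h)) =
      c * ((∫ t, f t) * ∫ t, g t) + β₀ * ((∫ t, t * f t) * ∫ t, g t) +
        β₁ * ((∫ t, f t) * ∫ t, t * g t) + β₂ * ((∫ t, f t) * (∫ t, g t) * (2 * a)) := by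
  have i1 : ∀ {q : ℝ → ℝ}, Continuous q → HasCompactSupport q → Integrable q := fun hq hqc =>
    hq.integrable_of_hasCompactSupport hqc
  have i2 : ∀ {q : ℝ → ℝ}, Continuous q → HasCompactSupport q → Integrable fun t => t * q t :=
    fun hq hqc => (continuous_id.mul hq).integrable_of_hasCompactSupport hqc.mul_left
  have e : (fun x : E3 => tens f g (topWeight a h) x *
      (c + β₀ * x 0 + β₁ * x 1 + β₂ * (x 2 - h))) = fun x =>
      c * tens f g (topWeight a h) x + β₀ * tens (fun t => t * f t) g (topWeight a h) x +
      β₁ * tens f (fun t => t * g t) (topWeight a h) x +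
      β₂ * tens f g (fun t => topWeight a h t * (t - h)) x := by
    ext x
    simp only [tens]
    ring
  have j0 := (integrable_tens (i1 hf hfc) (i1 hg hgc) (topWeight_integrable (h := h) ha)).const_mul c
  have j1 := (integrable_tens (i2 hf hfc) (i1 hg hgc)
    (topWeight_integrable (h := h) ha)).const_mul β₀
  have j2 := (integrable_tens (i1 hf hfc) (i2 hg hgc)
    (topWeight_integrable (h := h) ha)).const_mul β₁
  have j3 := (integrable_tens (i1 hf hfc) (i1 hg hgc)
    (topWeight_mul_integrable (h := h) ha)).const_mul β₂
  have j01 := j0.add j1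
  have j012 := j01.add j2
  rw [e]
  refine (integral_add j012 j3).trans ?_
  refine (congrArg (· + _) (integral_add j01 j2)).trans ?_
  refine (congrArg (· + _ + _) (integral_add j0 j1)).trans ?_
  simp only [integral_const_mul, integral_tens, integral_topWeight ha hh,
    integral_topWeight_mul ha hh, mul_one]

/-! ### Gradient integrals over the cylinder and rigid motion in the upper layer. -/

lemma continuous_tangNorm : Continuous tangNorm := by
  unfold tangNorm
  fun_prop

lemma measurableSet_nearCylinder (α k h σ : ℝ) : MeasurableSet (nearCylinder α k h σ) := by
  have h2 : Continuous fun x : E3 => x 2 := by fun_prop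
  exact ((isOpen_lt continuous_tangNorm continuous_const).inter
    ((isOpen_lt continuous_const h2).inter (isOpen_lt h2 continuous_const))).measurableSet

lemma volume_nearCylinder_le {α k h σ : ℝ} (hσ : 0 < σ) :
    volume (nearCylinder α k h σ) ≤
      ENNReal.ofReal (4 * σ ^ 2 * (h + 3 * (k * σ ^ (1 + α)))) := by
  set a := k * σ ^ (1 + α) with ha
  set l : Fin 3 → ℝ := ![-σ, -σ, -a]
  set r : Fin 3 → ℝ := ![σ, σ, h + 2 * a]
  have hsub : nearCylinder α k h σ ⊆ (fun x : E3 => x.ofLp) ⁻¹'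
      (Set.univ.pi fun i => Set.Ioo (l i) (r i)) := by
    rintro x ⟨h1, h2, h3⟩
    have e0 : |x 0| < σ := lt_of_le_of_lt (Real.abs_le_sqrt (by nlinarith [sq_nonneg (x 1)])) h1
    have e1 : |x 1| < σ := lt_of_le_of_lt (Real.abs_le_sqrt (by nlinarith [sq_nonneg (x 0)])) h1
    rw [abs_lt] at e0 e1
    intro i _
    fin_cases i
    · exact e0
    · exact e1
    · exact ⟨h2, by simp only [r, ha]; simpa [mul_assoc] using h3⟩
  refine (measure_mono hsub).trans ?_
  rw [(PiLp.volume_preserving_ofLp (Fin 3)).measure_preimage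
    (MeasurableSet.univ_pi fun _ => measurableSet_Ioo).nullMeasurableSet, Real.volume_pi_Ioo,
    Fin.prod_univ_three]
  simp only [l, r, Matrix.cons_val_zero, Matrix.cons_val_one, Matrix.cons_val]
  rw [← ENNReal.ofReal_mul (by linarith), ← ENNReal.ofReal_mul (by nlinarith)]
  apply le_of_eq
  congr 1
  ring

lemma abs_setIntegral_mul_grad_le {Ω : Set E3} {p : ℝ} (hΩ : IsOpen Ω) (hp : 1 ≤ p)
    {G : E3 → Grad3} (hG : MemLp G (ENNReal.ofReal p) (volume.restrict Ω)) {α k h σ : ℝ}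
    (hσ : 0 < σ) (hL : 0 ≤ h + 3 * (k * σ ^ (1 + α))) {Φ : E3 → ℝ} {M : ℝ} (hM0 : 0 ≤ M)
    (hM : ∀ x ∈ Ω, x ∈ nearCylinder α k h σ → |Φ x| ≤ M)
    (h0 : ∀ x ∈ Ω, x ∉ nearCylinder α k h σ → Φ x = 0) (i j : Fin 3) :
    |∫ x in Ω, Φ x * G x i j| ≤ M * ((4 * σ ^ 2 * (h + 3 * (k * σ ^ (1 + α)))) ^ (1 - 1 / p) *
      gradNorm Ω p G (nearCylinder α k h σ)) := by
  have hp' : 0 ≤ 1 - 1 / p := by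
    rw [sub_nonneg, div_le_one (by linarith)]; exact hp
  have h1 := enorm_setIntegral_mul_le hΩ.measurableSet (measurableSet_nearCylinder α k h σ) hp hG.1
    (g := fun x => G x i j)
    (fun x => (PiLp.norm_apply_le (G x i) j).trans (PiLp.norm_apply_le (G x) i)) hM h0
  -- Finiteness is needed because `gradNorm` is a `toReal`, which would turn an infinite norm into
  -- 0.
  have hfin : eLpNorm (Ω.indicator G) (ENNReal.ofReal p)
      (volume.restrict (nearCylinder α k h σ)) ≠ ⊤ := by
    refine ne_top_of_le_ne_top hG.2.ne ?_
    rw [← eLpNorm_indicator_eq_eLpNorm_restrict hΩ.measurableSet]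
    exact eLpNorm_mono_measure _ Measure.restrict_le_self
  have hb : 0 ≤ 4 * σ ^ 2 * (h + 3 * (k * σ ^ (1 + α))) := by positivity
  have h2 : ‖∫ x in Ω, Φ x * G x i j‖ₑ ≤ ENNReal.ofReal (M *
      ((4 * σ ^ 2 * (h + 3 * (k * σ ^ (1 + α)))) ^ (1 - 1 / p) *
        gradNorm Ω p G (nearCylinder α k h σ))) := by
    refine h1.trans ?_
    rw [ENNReal.ofReal_mul hM0, ENNReal.ofReal_mul (by positivity), gradNorm,
      ENNReal.ofReal_toReal hfin, mul_comm (eLpNorm _ _ _), ← ENNReal.ofReal_rpow_of_nonneg hb hp']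
    gcongr
    exact volume_nearCylinder_le hσ
  rw [Real.enorm_eq_ofReal_abs] at h2
  exact (ENNReal.ofReal_le_ofReal_iff (mul_nonneg hM0
    (mul_nonneg (Real.rpow_nonneg hb _) ENNReal.toReal_nonneg))).1 h2

/-- The square of half-side σ/2 lies inside the disc of radius σ. -/
lemma tangNorm_lt_of_tens_ne_zero {σ : ℝ} (hσ : 0 < σ) {f g w : ℝ → ℝ}
    (hf : ∀ t, σ / 2 < |t| → f t = 0) (hg : ∀ t, σ / 2 < |t| → g t = 0) {x : E3}
    (hx : tens f g w x ≠ 0) : tangNorm x < σ := by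
  have hx' : f (x 0) * g (x 1) * w (x 2) ≠ 0 := hx
  simp only [ne_eq, mul_eq_zero, not_or] at hx'
  have h0 : |x 0| ≤ σ / 2 := not_lt.1 fun h => hx'.1.1 (hf _ h)
  have h1 : |x 1| ≤ σ / 2 := not_lt.1 fun h => hx'.1.2 (hg _ h)
  have h0' := sq_le_sq' (abs_le.1 h0).1 (abs_le.1 h0).2
  have h1' := sq_le_sq' (abs_le.1 h1).1 (abs_le.1 h1).2
  rw [tangNorm, Real.sqrt_lt' hσ]
  nlinarith

/-- Over the disc `|x'| < σ`, the layer of thickness `a` below `-a` does not meet `Ω`, and the layer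
of thickness `a` above `h + a` belongs to `S`. -/
structure LayersSeparated (S Ω : Set E3) (a h σ : ℝ) : Prop where
  below : ∀ x : E3, tangNorm x < σ → a ≤ -x 2 → -x 2 ≤ 2 * a → x ∉ Ω
  above : ∀ x : E3, tangNorm x < σ → h + a < x 2 → x 2 ≤ h + 2 * a → x ∈ S

/-- The weight reaches down to -2a, but its part below -a misses Ω; hence within Ω it lives in the
cylinder, and w needs a bound only for t ≥ -a. -/
lemma abs_setIntegral_tens_grad_le {S Ω : Set E3} {p : ℝ} (hΩ : IsOpen Ω) (hp : 1 ≤ p)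
    {G : E3 → Grad3} (hG : MemLp G (ENNReal.ofReal p) (volume.restrict Ω)) {α k h σ a : ℝ}
    (hσ : 0 < σ) (hh : 0 ≤ h) (ha : a = k * σ ^ (1 + α)) (ha0 : 0 < a)
    (hlay : LayersSeparated S Ω a h σ) {f g w : ℝ → ℝ} {A B C : ℝ}
    (hf : ∀ t, σ / 2 < |t| → f t = 0) (hg : ∀ t, σ / 2 < |t| → g t = 0)
    (hw : ∀ t ∉ Set.Ioo (-2 * a) (h + 2 * a), w t = 0) (hA : ∀ t, |f t| ≤ A)
    (hB : ∀ t, |g t| ≤ B) (hC : ∀ t, -a ≤ t → |w t| ≤ C) (i j : Fin 3) :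
    |∫ x in Ω, tens f g w x * G x i j| ≤ A * B * C *
      ((4 * σ ^ 2 * (h + 3 * a)) ^ (1 - 1 / p) * gradNorm Ω p G (nearCylinder α k h σ)) := by
  have hA0 : 0 ≤ A := (abs_nonneg _).trans (hA 0)
  have hB0 : 0 ≤ B := (abs_nonneg _).trans (hB 0)
  have hC0 : 0 ≤ C := (abs_nonneg _).trans (hC 0 (by linarith))
  rw [ha]
  refine abs_setIntegral_mul_grad_le hΩ hp hG hσ (by rw [← ha]; positivity) (by positivity)
    (fun x _ hx => ?_) (fun x hx hxA => ?_) i j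
  · rw [tens, abs_mul, abs_mul]
    gcongr
    · exact hA _
    · exact hB _
    · exact hC _ (by rw [ha]; exact hx.2.1.le)
  · by_contra hne
    have ht := tangNorm_lt_of_tens_ne_zero hσ hf hg hne
    have hw2 : x 2 ∈ Set.Ioo (-2 * a) (h + 2 * a) :=
      by_contra fun h' => hne (by rw [tens, hw _ h', mul_zero])
    apply hxA
    refine ⟨ht, ?_, ?_⟩
    · rw [← ha]
      by_contra! hle
      exact hlay.below x ht (by linarith) (by linarith [hw2.1]) hx
    · rw [mul_assoc, ← ha]
      exact hw2.2

/-- The second derivative of the profile lives in the two layers only: the lower one misses Ω, and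
in the upper one, contained in S, u equals v almost everywhere. -/
lemma setIntegral_tens_mul_eq_rigid {S Ω : Set E3} (hΩ : IsOpen Ω) (hS : IsOpen S) (hSΩ : S ⊆ Ω)
    {u v : E3 → E3} (hu : ∀ᵐ x ∂(volume.restrict S), u x = v x) {a h σ : ℝ} (hσ : 0 < σ)
    (ha : 0 < a) (hlay : LayersSeparated S Ω a h σ) {f g : ℝ → ℝ}
    (hf : ∀ t, σ / 2 < |t| → f t = 0) (hg : ∀ t, σ / 2 < |t| → g t = 0) (j : Fin 3) :
    ∫ x in Ω, tens f g (deriv (deriv (vertProfile a h))) x * u x j =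
      ∫ x, tens f g (topWeight a h) x * v x j := by
  have hmem : ∀ x, tens f g (topWeight a h) x ≠ 0 → x ∈ S := by
    intro x hx
    have ht := tangNorm_lt_of_tens_ne_zero hσ hf hg hx
    have hw : topWeight a h (x 2) ≠ 0 := fun h' => hx (by rw [tens, h', mul_zero])
    have h1 : x 2 ∈ Set.Ioi (h + a) := Set.mem_of_indicator_ne_zero hw
    rw [topWeight, Set.indicator_of_mem h1] at hw
    have h2 := not_imp_comm.1 (vertProfile_deriv_deriv_eq_zero ha) hw
    exact hlay.above x ht h1 h2.2
  have hzero : ∀ x ∉ Ω, tens f g (topWeight a h) x * v x j = 0 := fun x hx => by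
    rw [not_imp_comm.1 (hmem x) fun h' => hx (hSΩ h'), zero_mul]
  rw [← setIntegral_eq_integral_of_forall_compl_eq_zero hzero]
  rw [ae_restrict_iff' hS.measurableSet] at hu
  refine integral_congr_ae ?_
  filter_upwards [ae_restrict_mem hΩ.measurableSet, ae_restrict_of_ae hu] with x hx hux
  by_cases htop : h + a < x 2
  · have e : tens f g (deriv (deriv (vertProfile a h))) x = tens f g (topWeight a h) x := by
      rw [tens, tens, topWeight, Set.indicator_of_mem (Set.mem_Ioi.2 htop)]
    rw [e]
    by_cases h0 : tens f g (topWeight a h) x = 0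
    · rw [h0, zero_mul, zero_mul]
    · rw [hux (hmem x h0)]
  · have e : tens f g (topWeight a h) x = 0 := by
      rw [tens, topWeight, Set.indicator_of_notMem (by simpa using htop), mul_zero]
    rw [e, zero_mul]
    by_contra hne
    have hne := left_ne_zero_of_mul hne
    have ht := tangNorm_lt_of_tens_ne_zero hσ hf hg hne
    have hw : deriv (deriv (vertProfile a h)) (x 2) ≠ 0 := fun h' =>
      hne (by rw [tens, h', mul_zero])
    have h2 := not_imp_comm.1 (vertProfile_deriv_deriv_eq_zero ha) hw
    rcases le_or_gt (x 2) (-a) with h3 | h3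
    · exact hlay.below x ht (by linarith) (by linarith [h2.1]) hx
    · exact hw (vertProfile_deriv_deriv_eq ha ⟨by linarith, by linarith⟩)

/-! ### Moment estimates for the rigid velocity. -/

lemma cross_components (a b : E3) : cross a b 0 = a 1 * b 2 - a 2 * b 1 ∧
    cross a b 1 = a 2 * b 0 - a 0 * b 2 ∧ cross a b 2 = a 0 * b 1 - a 1 * b 0 := by
  simp [cross, cross_apply]

/-- The expansion is about P; the zero coefficients give every component the form required by
`integral_tens_topWeight_mul_affine`. -/
lemma rigidVelocity_apply (uStar ω xStar x : E3) (h : ℝ) :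
    rigidVelocity uStar ω xStar x 0 = rigidVelocity uStar ω xStar (axisPoint h) 0 + 0 * x 0 +
        (-ω 2) * x 1 + ω 1 * (x 2 - h) ∧
    rigidVelocity uStar ω xStar x 1 = rigidVelocity uStar ω xStar (axisPoint h) 1 + ω 2 * x 0 +
        0 * x 1 + (-ω 0) * (x 2 - h) ∧
    rigidVelocity uStar ω xStar x 2 = rigidVelocity uStar ω xStar (axisPoint h) 2 +
        (-ω 1) * x 0 + ω 0 * x 1 + 0 * (x 2 - h) := by
  simp only [rigidVelocity, PiLp.add_apply, cross_components, PiLp.sub_apply]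
  refine ⟨?_, ?_, ?_⟩ <;> simp [axisPoint] <;> ring

/-- Estimates of the moments of the normal and tangential velocity over the upper layer by the
gradient in the gap. -/
lemma abs_integral_topWeight_le {S Ω : Set E3} (hΩ : IsOpen Ω) (hS : IsOpen S) (hSΩ : S ⊆ Ω)
    {p : ℝ} (hp : 1 ≤ p) {u : E3 → E3} {G : E3 → Grad3} (hu : MemW0 Ω p u G)
    (hdiv : DivFree Ω G) {v : E3 → E3} (huv : ∀ᵐ x ∂(volume.restrict S), u x = v x)
    {α k h σ a : ℝ} (hσ : 0 < σ) (hh : 0 ≤ h) (ha : a = k * σ ^ (1 + α)) (ha0 : 0 < a)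
    (hlay : LayersSeparated S Ω a h σ) {f g : ℝ → ℝ}
    (hf : ContDiff ℝ (⊤ : ℕ∞) f) (hg : ContDiff ℝ (⊤ : ℕ∞) g)
    (hf0 : ∀ t, σ / 2 < |t| → f t = 0) (hg0 : ∀ t, σ / 2 < |t| → g t = 0)
    (hdf0 : ∀ t, σ / 2 < |t| → deriv f t = 0) (hdg0 : ∀ t, σ / 2 < |t| → deriv g t = 0)
    {A A' c : ℝ} (hfA : ∀ t, |f t| ≤ A) (hgA : ∀ t, |g t| ≤ A) (hdf : ∀ t, |deriv f t| ≤ A')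
    (hdg : ∀ t, |deriv g t| ≤ A') (hc : ∀ s, |deriv smoothRamp s| ≤ c) :
    |∫ x, tens f g (topWeight a h) x * v x 2| ≤ 2 * (A * A' * (h + 3 * a)) *
      ((4 * σ ^ 2 * (h + 3 * a)) ^ (1 - 1 / p) * gradNorm Ω p G (nearCylinder α k h σ)) ∧
    ∀ j, |∫ x, tens f g (topWeight a h) x * v x j| ≤ A * A * c *
      ((4 * σ ^ 2 * (h + 3 * a)) ^ (1 - 1 / p) * gradNorm Ω p G (nearCylinder α k h σ)) := by
  have cpt : ∀ {q : ℝ → ℝ}, (∀ t, σ / 2 < |t| → q t = 0) → HasCompactSupport q := fun hq =>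
    HasCompactSupport.intro (isCompact_Icc (a := -(σ / 2)) (b := σ / 2)) fun t ht =>
      hq t (by rw [Set.mem_Icc, ← abs_le] at ht; exact not_le.1 ht)
  have hX := vertProfile_contDiff (a := a) (h := h)
  have hX' := vertProfile_deriv_contDiff (a := a) (h := h)
  have hXc := vertProfile_hasCompactSupport (h := h) ha0
  have hXc' := hXc.deriv
  have hdfs : ContDiff ℝ (⊤ : ℕ∞) (deriv f) := (contDiff_infty_iff_deriv.1 hf).2
  have hdgs : ContDiff ℝ (⊤ : ℕ∞) (deriv g) := (contDiff_infty_iff_deriv.1 hg).2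
  have hX0 : ∀ t ∉ Set.Ioo (-2 * a) (h + 2 * a), vertProfile a h t = 0 := fun t ht =>
    eq_zero_of_notMem_Ioo hX.continuous (fun t ht => vertProfile_eq_zero ha0 ht) ht
  have hX0' : ∀ t ∉ Set.Ioo (-2 * a) (h + 2 * a), deriv (vertProfile a h) t = 0 := fun t ht =>
    eq_zero_of_notMem_Ioo hX'.continuous (fun t ht => vertProfile_deriv_eq_zero ha0 ht) ht
  constructor
  · rw [← setIntegral_tens_mul_eq_rigid hΩ hS hSΩ huv hσ ha0 hlay hf0 hg0]
    have w := fun i : Fin 3 => hu.integral_fderiv_mul hΩ hp (tens_contDiff hf hg hX')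
      (tens_hasCompactSupport (cpt hf0) (cpt hg0) hXc') i i
    have w0 := w 0
    have w1 := w 1
    have w2 := w 2
    simp only [fderiv_tens hf hg hX'] at w0 w1 w2
    -- With X the profile, the second vertical integration by parts trades f' g X' u₁ for f' g X
    -- ∂₃u₁, and likewise for u₂; this gains the factor h + 3a.
    have z0 := hu.integral_fderiv_mul hΩ hp (tens_contDiff hdfs hg hX)
      (tens_hasCompactSupport (cpt hdf0) (cpt hg0) hXc) 2 0
    have z1 := hu.integral_fderiv_mul hΩ hp (tens_contDiff hf hdgs hX)
      (tens_hasCompactSupport (cpt hf0) (cpt hdg0) hXc) 2 1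
    simp only [fderiv_tens hdfs hg hX] at z0
    simp only [fderiv_tens hf hdgs hX] at z1
    have hint : ∀ i : Fin 3, Integrable
        (fun x => tens f g (deriv (vertProfile a h)) x * G x i i) (volume.restrict Ω) := fun i =>
      integrableOn_mul_of_memLp hp (MemLp.gradComponent hu.memLp_grad i i)
        (tens_contDiff hf hg hX').continuous (tens_hasCompactSupport (cpt hf0) (cpt hg0) hXc')
    have hsum : ∑ i : Fin 3, ∫ x in Ω, tens f g (deriv (vertProfile a h)) x * G x i i = 0 := by
      rw [← integral_finsetSum _ fun i _ => hint i]
      refine integral_eq_zero_of_ae ?_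
      filter_upwards [hdiv] with x hx
      rw [← Finset.mul_sum, hx, mul_zero]
      rfl
    rw [Fin.sum_univ_three] at hsum
    have hXL : ∀ t, -a ≤ t → |vertProfile a h t| ≤ h + 3 * a := fun t ht =>
      vertProfile_abs_le ha0 hh ht
    have b0 := abs_setIntegral_tens_grad_le hΩ hp hu.memLp_grad hσ hh ha ha0 hlay hdf0 hg0 hX0
      hdf hgA hXL 2 0
    have b1 := abs_setIntegral_tens_grad_le hΩ hp hu.memLp_grad hσ hh ha ha0 hlay hf0 hdg0 hX0
      hfA hdg hXL 2 1
    rw [show ∫ x in Ω, tens f g (deriv (deriv (vertProfile a h))) x * u x 2 =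
      (∫ x in Ω, tens (deriv f) g (vertProfile a h) x * G x 2 0) +
        ∫ x in Ω, tens f (deriv g) (vertProfile a h) x * G x 2 1 by linarith]
    refine (abs_add_le _ _).trans ((add_le_add b0 b1).trans (le_of_eq ?_))
    ring
  · intro j
    rw [← setIntegral_tens_mul_eq_rigid hΩ hS hSΩ huv hσ ha0 hlay hf0 hg0]
    have w := hu.integral_fderiv_mul hΩ hp (tens_contDiff hf hg hX')
      (tens_hasCompactSupport (cpt hf0) (cpt hg0) hXc') 2 j
    simp only [fderiv_tens hf hg hX'] at w
    rw [w, abs_neg]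
    exact abs_setIntegral_tens_grad_le hΩ hp hu.memLp_grad hσ hh ha ha0 hlay hf0 hg0 hX0'
      hfA hgA (fun t ht => vertProfile_deriv_abs_le ha0 hc ht) 2 j

/-! ### Horizontal profiles and their scaling. -/

/-- A smooth function supported in `[-1/2, 1/2]`, with a bound for it and its derivative. -/
structure IsProfile (q : ℝ → ℝ) (D : ℝ) : Prop where
  contDiff : ContDiff ℝ (⊤ : ℕ∞) q
  eq_zero : ∀ t, 1 / 2 < |t| → q t = 0
  abs_le : ∀ t, |q t| ≤ D
  deriv_abs_le : ∀ t, |deriv q t| ≤ D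

lemma exists_isProfile {q : ℝ → ℝ} (hq : ContDiff ℝ (⊤ : ℕ∞) q)
    (h0 : ∀ t, 1 / 2 < |t| → q t = 0) : ∃ D, IsProfile q D := by
  have hc : HasCompactSupport q :=
    HasCompactSupport.intro (isCompact_Icc (a := -(1 / 2)) (b := 1 / 2)) fun t ht =>
      h0 t (by rw [Set.mem_Icc, ← abs_le] at ht; exact not_le.1 ht)
  obtain ⟨D₁, h₁⟩ := hq.continuous.bounded_above_of_compact_support hc
  obtain ⟨D₂, h₂⟩ := (hq.continuous_deriv (by simp)).bounded_above_of_compact_support hc.deriv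
  exact ⟨max D₁ D₂, hq, h0, fun t => (h₁ t).trans (le_max_left _ _),
    fun t => (h₂ t).trans (le_max_right _ _)⟩

/-- An even and an odd profile with nonvanishing moments. -/
lemma exists_profiles : ∃ (q r : ℝ → ℝ) (D m₀ m₂ : ℝ), 0 < D ∧ 0 < m₀ ∧ 0 < m₂ ∧ IsProfile q D ∧
    IsProfile r D ∧ ∫ t, q t = m₀ ∧ ∫ t, t * q t = 0 ∧ ∫ t, r t = 0 ∧ ∫ t, t * r t = m₂ := by
  -- The even profile is a symmetric bump b, the odd one is t b(t).
  let b : ContDiffBump (0 : ℝ) := ⟨1 / 4, 1 / 2, by norm_num, by norm_num⟩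
  have hb0 : ∀ t, 1 / 2 < |t| → b t = 0 := fun t ht =>
    b.zero_of_le_dist (by simpa [b] using ht.le)
  obtain ⟨D₁, h₁⟩ := exists_isProfile b.contDiff hb0
  obtain ⟨D₂, h₂⟩ := exists_isProfile (q := fun t => t * b t) (contDiff_id.mul b.contDiff)
    (fun t ht => by rw [hb0 t ht, mul_zero])
  have hodd : ∫ t, t * b t = 0 := by
    have h := integral_neg_eq_self (μ := volume) fun t : ℝ => t * b t
    simp only [b.neg, neg_mul, integral_neg] at h
    linarith
  have hcont : Continuous fun t => t * (t * b t) :=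
    continuous_id.mul (continuous_id.mul b.continuous)
  refine ⟨b, fun t => t * b t, max 1 (max D₁ D₂), _, _, by positivity, b.integral_pos, ?_,
    ⟨h₁.1, h₁.2, fun t => (h₁.3 t).trans ?_, fun t => (h₁.4 t).trans ?_⟩,
    ⟨h₂.1, h₂.2, fun t => (h₂.3 t).trans ?_, fun t => (h₂.4 t).trans ?_⟩, rfl, hodd, hodd, rfl⟩
  · refine hcont.integral_pos_of_hasCompactSupport_nonneg_nonzero
      b.hasCompactSupport.mul_left.mul_left
      (fun t => ?_) (x := 1 / 8) ?_
    · simp only [Pi.zero_apply, ← mul_assoc]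
      exact mul_nonneg (mul_self_nonneg t) b.nonneg
    · have : b (1 / 8) = 1 := b.one_of_mem_closedBall (by norm_num [b, abs_of_pos])
      simp only [this]
      norm_num
  all_goals simp

namespace IsProfile

variable {q : ℝ → ℝ} {D σ : ℝ}

lemma scaled_contDiff (hq : IsProfile q D) : ContDiff ℝ (⊤ : ℕ∞) fun t => q (t / σ) :=
  hq.contDiff.comp (contDiff_id.div_const σ)

lemma scaled_eq_zero (hq : IsProfile q D) (hσ : 0 < σ) (t : ℝ) (ht : σ / 2 < |t|) :
    q (t / σ) = 0 := by
  apply hq.eq_zero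
  rw [abs_div, abs_of_pos hσ, lt_div_iff₀ hσ]
  linarith

lemma scaled_deriv_eq_zero (hq : IsProfile q D) (hσ : 0 < σ) (t : ℝ) (ht : σ / 2 < |t|) :
    deriv (fun t => q (t / σ)) t = 0 := by
  have : (fun t => q (t / σ)) =ᶠ[𝓝 t] fun _ => 0 := by
    filter_upwards [(continuous_abs.tendsto t).eventually_const_lt ht] with s hs using
      hq.scaled_eq_zero hσ s hs
  rw [this.deriv_eq, deriv_const]

lemma scaled_deriv_abs_le (hq : IsProfile q D) (hσ : 0 < σ) (t : ℝ) :
    |deriv (fun t => q (t / σ)) t| ≤ D / σ := by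
  have h := ((hq.contDiff.differentiable (by simp) (t / σ)).hasDerivAt).comp t
    ((hasDerivAt_id t).div_const σ)
  have h' : deriv (fun t => q (t / σ)) t = deriv q (t / σ) * (1 / σ) := h.deriv
  rw [h', abs_mul, abs_of_pos (one_div_pos.2 hσ), mul_one_div]
  exact div_le_div_of_nonneg_right (hq.deriv_abs_le _) hσ.le

lemma scaled_hasCompactSupport (hq : IsProfile q D) (hσ : 0 < σ) :
    HasCompactSupport fun t => q (t / σ) :=
  HasCompactSupport.intro (isCompact_Icc (a := -(σ / 2)) (b := σ / 2)) fun t ht =>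
    hq.scaled_eq_zero hσ t (by rw [Set.mem_Icc, ← _root_.abs_le] at ht; exact not_le.1 ht)

end IsProfile

lemma integral_scaled (q : ℝ → ℝ) {σ : ℝ} (hσ : 0 < σ) : ∫ t, q (t / σ) = σ * ∫ t, q t := by
  rw [Measure.integral_comp_div, abs_of_pos hσ, smul_eq_mul]

lemma integral_mul_scaled (q : ℝ → ℝ) {σ : ℝ} (hσ : 0 < σ) :
    ∫ t, t * q (t / σ) = σ ^ 2 * ∫ t, t * q t := by
  have e : (fun t => t * q (t / σ)) = fun t => σ * ((fun s => s * q s) (t / σ)) := by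
    ext t
    field_simp
  rw [e, integral_const_mul, integral_scaled (fun s => s * q s) hσ]
  ring

/-- The moments of a rigid velocity over the upper layer. -/
lemma integral_topWeight_mul_rigidVelocity {a h σ : ℝ} (ha : 0 < a) (hh : 0 ≤ h) (hσ : 0 < σ)
    {f g : ℝ → ℝ} {D : ℝ} (hf : IsProfile f D) (hg : IsProfile g D) (uStar ω xStar : E3) :
    ∫ x, tens (fun t => f (t / σ)) (fun t => g (t / σ)) (topWeight a h) x *
        rigidVelocity uStar ω xStar x 0 =
      σ ^ 2 * ((rigidVelocity uStar ω xStar (axisPoint h) 0 + 2 * a * ω 1) *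
        ((∫ t, f t) * ∫ t, g t) - σ * (ω 2 * ((∫ t, f t) * ∫ t, t * g t))) ∧
    ∫ x, tens (fun t => f (t / σ)) (fun t => g (t / σ)) (topWeight a h) x *
        rigidVelocity uStar ω xStar x 1 =
      σ ^ 2 * ((rigidVelocity uStar ω xStar (axisPoint h) 1 - 2 * a * ω 0) *
        ((∫ t, f t) * ∫ t, g t) + σ * (ω 2 * ((∫ t, t * f t) * ∫ t, g t))) ∧
    ∫ x, tens (fun t => f (t / σ)) (fun t => g (t / σ)) (topWeight a h) x *
        rigidVelocity uStar ω xStar x 2 =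
      σ ^ 2 * (rigidVelocity uStar ω xStar (axisPoint h) 2 * ((∫ t, f t) * ∫ t, g t) +
        σ * (ω 0 * ((∫ t, f t) * ∫ t, t * g t) - ω 1 * ((∫ t, t * f t) * ∫ t, g t))) := by
  have mom := integral_tens_topWeight_mul_affine ha hh (hf.scaled_contDiff (σ := σ)).continuous
    (hf.scaled_hasCompactSupport hσ) (hg.scaled_contDiff (σ := σ)).continuous
    (hg.scaled_hasCompactSupport hσ)
  simp only [integral_scaled _ hσ, integral_mul_scaled _ hσ] at mom
  refine ⟨?_, ?_, ?_⟩
  · refine (integral_congr_ae (ae_of_all _ fun x => congrArg (_ * ·)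
      (rigidVelocity_apply uStar ω xStar x h).1)).trans ((mom _ _ _ _).trans ?_)
    ring
  · refine (integral_congr_ae (ae_of_all _ fun x => congrArg (_ * ·)
      (rigidVelocity_apply uStar ω xStar x h).2.1)).trans ((mom _ _ _ _).trans ?_)
    ring
  · refine (integral_congr_ae (ae_of_all _ fun x => congrArg (_ * ·)
      (rigidVelocity_apply uStar ω xStar x h).2.2)).trans ((mom _ _ _ _).trans ?_)
    ring

/-! ### Assembling the estimates. -/

lemma layersSeparated_of_adaptedCoordinates {α k σ₀ : ℝ} (hα : 0 < α) (hk : 0 < k) (hσ₀ : 0 < σ₀)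
    {S Ω : Set E3} {h : ℝ} (hΩ : IsUniformlyC1 α k σ₀ Ω) (hS : IsUniformlyC1 α k σ₀ S)
    (hSΩ : S ⊆ Ω) (hh : 0 ≤ h) (hc : AdaptedCoordinates S Ω h) {σ : ℝ} (hσ : 0 < σ)
    (hσσ₀ : σ ≤ σ₀ / 2) : LayersSeparated S Ω (k * σ ^ (1 + α)) h σ := by
  -- This is where σ ≤ σ₀/2 enters: heights up to 2a must stay within the range of the local
  -- description, and 2^{1+α} > 2.
  have h2 : 2 * (k * σ ^ (1 + α)) < k * σ₀ ^ (1 + α) := by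
    have h3 : (2 * σ) ^ (1 + α) ≤ σ₀ ^ (1 + α) :=
      Real.rpow_le_rpow (by positivity) (by linarith) (by positivity)
    rw [Real.mul_rpow (by norm_num) hσ.le] at h3
    have h4 : (2 : ℝ) < 2 ^ (1 + α) := by
      conv_lhs => rw [← Real.rpow_one 2]
      exact Real.rpow_lt_rpow_of_exponent_lt (by norm_num) (by linarith)
    have h5 : 0 < σ ^ (1 + α) := by positivity
    nlinarith [mul_lt_mul_of_pos_right h4 h5]
  have h6 : ∀ x : E3, tangNorm x < σ → k * tangNorm x ^ (1 + α) < k * σ ^ (1 + α) := fun x hx =>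
    mul_lt_mul_of_pos_left (Real.rpow_lt_rpow (tangNorm_nonneg x) hx (by positivity)) hk
  exact ⟨fun x hx h1 h3 => notMem_of_below hα hk hσ₀ hΩ hc (by linarith)
      (by linarith [h6 x hx]) (by linarith),
    fun x hx h1 h3 => mem_of_above hα hk hσ₀ hS hSΩ hh hc (by linarith)
      (by linarith [h6 x hx]) (by linarith)⟩

lemma tangNorm_le (x : E3) : tangNorm x ≤ |x 0| + |x 1| := by
  refine Real.sqrt_le_iff.2 ⟨by positivity, ?_⟩
  nlinarith [sq_abs (x 0), sq_abs (x 1), mul_nonneg (abs_nonneg (x 0)) (abs_nonneg (x 1))]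

lemma rpow_one_sub_mul_le {p σ L : ℝ} (hp : 1 ≤ p) (hσ : 0 < σ) (hL : 0 < L) :
    (4 * σ ^ 2 * L) ^ (1 - 1 / p) ≤ 4 * σ ^ 2 * (σ ^ (-(2 / p)) * L ^ (2 - 1 / p)) / L := by
  have hp0 : 0 < p := by linarith
  have e1 : (σ ^ 2) ^ (1 - 1 / p) = σ ^ 2 * σ ^ (-(2 / p)) := by
    rw [← Real.rpow_natCast σ 2, ← Real.rpow_mul hσ.le, ← Real.rpow_add hσ]
    congr 1
    push_cast
    ring
  have e2 : L ^ (1 - 1 / p) = L ^ (2 - 1 / p) / L := by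
    rw [show 1 - 1 / p = (2 - 1 / p) - 1 by ring, Real.rpow_sub_one hL.ne']
  -- This keeps the final constant independent of p.
  have e3 : (4 : ℝ) ^ (1 - 1 / p) ≤ 4 := by
    conv_rhs => rw [← Real.rpow_one 4]
    exact Real.rpow_le_rpow_of_exponent_le (by norm_num) (by
      have : 0 < 1 / p := by positivity
      linarith)
  rw [Real.mul_rpow (by positivity) hL.le, Real.mul_rpow (by norm_num) (by positivity), e1, e2]
  calc 4 ^ (1 - 1 / p) * (σ ^ 2 * σ ^ (-(2 / p))) * (L ^ (2 - 1 / p) / L)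
      ≤ 4 * (σ ^ 2 * σ ^ (-(2 / p))) * (L ^ (2 - 1 / p) / L) := by gcongr
    _ = _ := by ring

lemma abs_le_of_moment {m x s B : ℝ} (hs : 0 < s) (hm : 0 < m) (h : |s * m * x| ≤ B) :
    |x| ≤ B / (s * m) := by
  rwa [le_div_iff₀ (by positivity), mul_comm, ← abs_of_pos (show 0 < s * m by positivity),
    ← abs_mul]

/-- Estimates of the rigid velocity and the angular velocity by the gradient in the gap, with an
absolute constant. -/
lemma exists_rigid_bound : ∃ K : ℝ, 0 < K ∧ ∀ (Ω S : Set E3), IsOpen Ω → IsOpen S → S ⊆ Ω →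
    ∀ (p : ℝ), 1 ≤ p → ∀ (u : E3 → E3) (G : E3 → Grad3) (uStar ω xStar : E3),
      MemW0Rigid S Ω p u G uStar ω xStar → DivFree Ω G →
    ∀ (α k h σ a N : ℝ), 0 < σ → 0 ≤ h → a = k * σ ^ (1 + α) → 0 < a → LayersSeparated S Ω a h σ →
      N = (4 * σ ^ 2 * (h + 3 * a)) ^ (1 - 1 / p) * gradNorm Ω p G (nearCylinder α k h σ) →
      |rigidVelocity uStar ω xStar (axisPoint h) 2| ≤ K * (N * (h + 3 * a) / σ ^ 3) ∧
      |ω 0| ≤ K * (N * (h + 3 * a) / σ ^ 4) ∧ |ω 1| ≤ K * (N * (h + 3 * a) / σ ^ 4) ∧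
      |ω 2| ≤ K * (N / σ ^ 3) ∧
      |rigidVelocity uStar ω xStar (axisPoint h) 0 + 2 * a * ω 1| ≤ K * (N / σ ^ 2) ∧
      |rigidVelocity uStar ω xStar (axisPoint h) 1 - 2 * a * ω 0| ≤ K * (N / σ ^ 2) := by
  obtain ⟨c, hc0, hc⟩ := exists_deriv_smoothRamp_bound
  obtain ⟨q, r, D, m₀, m₂, hD, hm₀, hm₂, hq, hr, hq0, hq1, hr0, hr1⟩ := exists_profiles
  have hkey : ∃ K : ℝ, 0 < K ∧ 2 * D ^ 2 / (m₀ * m₀) ≤ K ∧ 2 * D ^ 2 / (m₀ * m₂) ≤ K ∧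
      D ^ 2 * c / (m₀ * m₀) ≤ K ∧ D ^ 2 * c / (m₀ * m₂) ≤ K :=
    ⟨max 1 (max (max (2 * D ^ 2 / (m₀ * m₀)) (2 * D ^ 2 / (m₀ * m₂)))
      (max (D ^ 2 * c / (m₀ * m₀)) (D ^ 2 * c / (m₀ * m₂)))),
      by positivity, by simp, by simp, by simp, by simp⟩
  obtain ⟨K, hK, hK1, hK2, hK3, hK4⟩ := hkey
  refine ⟨K, hK, ?_⟩
  intro Ω S hΩ hS hSΩ p hp u G uStar ω xStar hu hdiv α k h σ a N hσ hh0 ha ha0 hlay hN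
  have est := fun (f g : ℝ → ℝ) (hf : IsProfile f D) (hg : IsProfile g D) =>
    abs_integral_topWeight_le hΩ hS hSΩ hp hu.memW0 hdiv hu.rigid hσ hh0 ha ha0 hlay
      (hf.scaled_contDiff (σ := σ)) (hg.scaled_contDiff (σ := σ)) (hf.scaled_eq_zero hσ)
      (hg.scaled_eq_zero hσ) (hf.scaled_deriv_eq_zero hσ) (hg.scaled_deriv_eq_zero hσ)
      (fun t => hf.abs_le _) (fun t => hg.abs_le _) (hf.scaled_deriv_abs_le hσ)
      (hg.scaled_deriv_abs_le hσ) hc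
  simp only [← hN] at est
  have mom := fun (f g : ℝ → ℝ) (hf : IsProfile f D) (hg : IsProfile g D) =>
    integral_topWeight_mul_rigidVelocity ha0 hh0 hσ hf hg uStar ω xStar
  have hN0 : 0 ≤ N := by
    rw [hN]
    exact mul_nonneg (by positivity) ENNReal.toReal_nonneg
  have hL0 : 0 < h + 3 * a := by positivity
  refine ⟨?_, ?_, ?_, ?_, ?_, ?_⟩
  -- The even profile q has first moment 0 and the odd profile r has mass 0. Testing the normal
  -- component with q ⊗ q, q ⊗ r and r ⊗ q isolates the normal velocity, `ω 0` and `ω 1` in turn.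
  · have h1 := (est q q hq hq).1
    rw [(mom q q hq hq).2.2] at h1
    simp only [hq0, hq1] at h1
    have h2 := abs_le_of_moment (s := σ ^ 2) (m := m₀ * m₀)
      (x := rigidVelocity uStar ω xStar (axisPoint h) 2) (by positivity)
      (by positivity) (le_trans (le_of_eq (by congr 1; ring)) h1)
    calc _ ≤ _ := h2
      _ = 2 * D ^ 2 / (m₀ * m₀) * (N * (h + 3 * a) / σ ^ 3) := by field_simp
      _ ≤ _ := by gcongr
  · have h1 := (est q r hq hr).1
    rw [(mom q r hq hr).2.2] at h1
    simp only [hq0, hq1, hr0, hr1] at h1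
    have h2 := abs_le_of_moment (s := σ ^ 3) (m := m₀ * m₂) (x := ω 0) (by positivity)
      (by positivity) (le_trans (le_of_eq (by congr 1; ring)) h1)
    calc _ ≤ _ := h2
      _ = 2 * D ^ 2 / (m₀ * m₂) * (N * (h + 3 * a) / σ ^ 4) := by field_simp
      _ ≤ _ := by gcongr
  · have h1 := (est r q hr hq).1
    rw [(mom r q hr hq).2.2] at h1
    simp only [hq0, hq1, hr0, hr1] at h1
    have h2 := abs_le_of_moment (s := σ ^ 3) (m := m₀ * m₂) (x := -ω 1) (by positivity)
      (by positivity) (le_trans (le_of_eq (by congr 1; ring)) h1)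
    rw [abs_neg] at h2
    calc _ ≤ _ := h2
      _ = 2 * D ^ 2 / (m₀ * m₂) * (N * (h + 3 * a) / σ ^ 4) := by field_simp
      _ ≤ _ := by gcongr
  -- For the first tangential component, q ⊗ r kills the constant part and leaves `ω 2`.
  · have h1 := (est q r hq hr).2 0
    rw [(mom q r hq hr).1] at h1
    simp only [hq0, hr0, hr1] at h1
    have h2 := abs_le_of_moment (s := σ ^ 3) (m := m₀ * m₂) (x := -ω 2) (by positivity)
      (by positivity) (le_trans (le_of_eq (by congr 1; ring)) h1)
    rw [abs_neg] at h2
    calc _ ≤ _ := h2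
      _ = D ^ 2 * c / (m₀ * m₂) * (N / σ ^ 3) := by field_simp
      _ ≤ _ := by gcongr
  -- The top weight has first moment 2a about h, so q ⊗ q yields the velocity at height h + 2a
  -- rather than at P.
  · have h1 := (est q q hq hq).2 0
    rw [(mom q q hq hq).1] at h1
    simp only [hq0, hq1] at h1
    have h2 := abs_le_of_moment (s := σ ^ 2) (m := m₀ * m₀)
      (x := rigidVelocity uStar ω xStar (axisPoint h) 0 + 2 * a * ω 1) (by positivity)
      (by positivity) (le_trans (le_of_eq (by congr 1; ring)) h1)
    calc _ ≤ _ := h2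
      _ = D ^ 2 * c / (m₀ * m₀) * (N / σ ^ 2) := by field_simp
      _ ≤ _ := by gcongr
  · have h1 := (est q q hq hq).2 1
    rw [(mom q q hq hq).2.1] at h1
    simp only [hq0, hq1] at h1
    have h2 := abs_le_of_moment (s := σ ^ 2) (m := m₀ * m₀)
      (x := rigidVelocity uStar ω xStar (axisPoint h) 1 - 2 * a * ω 0) (by positivity)
      (by positivity) (le_trans (le_of_eq (by congr 1; ring)) h1)
    calc _ ≤ _ := h2
      _ = D ^ 2 * c / (m₀ * m₀) * (N / σ ^ 2) := by field_simp
      _ ≤ _ := by gcongr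

theorem theorem2p1 (α k σ₀ : ℝ) (hα : 0 < α) (hα1 : α ≤ 1) (hk : 0 < k) (hσ₀ : 0 < σ₀) :
    ∃ C : ℝ, 0 < C ∧
      ∀ (Ω S : Set E3), IsDomain3 Ω → IsDomain3 S → Bornology.IsBounded S → S ⊆ Ω →
        IsUniformlyC1 α k σ₀ Ω → IsUniformlyC1 α k σ₀ S →
      ∀ h : ℝ, AdaptedCoordinates S Ω h → h ∈ Set.Icc 0 (Metric.diam S) →
      ∀ (p : ℝ), 1 ≤ p →
      ∀ (u : E3 → E3) (G : E3 → Grad3) (uStar ω xStar : E3),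
        MemW0Rigid S Ω p u G uStar ω xStar → DivFree Ω G →
      ∀ σ ∈ Set.Ioc 0 (σ₀ / 2),
        |rigidVelocity uStar ω xStar (axisPoint h) 2| ≤
          C * σ ^ (-1 - 2 / p) * (h + 3 * k * σ ^ (1 + α)) ^ (2 - 1 / p) *
            gradNorm Ω p G (nearCylinder α k h σ) ∧
        tangNorm (rigidVelocity uStar ω xStar (axisPoint h)) ≤
          C * σ ^ (-1 - α - 2 / p) * (h + 3 * k * σ ^ (1 + α)) ^ (2 - 1 / p) *
            gradNorm Ω p G (nearCylinder α k h σ) ∧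
        tangNorm ω ≤
          C * σ ^ (-2 - 2 / p) * (h + 3 * k * σ ^ (1 + α)) ^ (2 - 1 / p) *
            gradNorm Ω p G (nearCylinder α k h σ) ∧
        |ω 2| ≤
          C * σ ^ (-2 - α - 2 / p) * (h + 3 * k * σ ^ (1 + α)) ^ (2 - 1 / p) *
            gradNorm Ω p G (nearCylinder α k h σ) := by
  obtain ⟨K₀, hK₀, hcore⟩ := exists_rigid_bound
  obtain ⟨K, hK, hK1, hK2⟩ : ∃ K : ℝ, 0 < K ∧ 4 * K₀ ≤ K ∧ 4 * K₀ / (3 * k) ≤ K :=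
    ⟨max (4 * K₀) (4 * K₀ / (3 * k)), by positivity, le_max_left _ _, le_max_right _ _⟩
  -- The first term comes from adding two tangential components, the second from correcting both by
  -- 2aω.
  refine ⟨2 * K + 4 * k * (σ₀ ^ α) ^ 2 * K, by positivity, ?_⟩
  intro Ω S hΩ hS _ hSΩ hΩ1 hS1 h hcoord hh p hp u G uStar ω xStar hu hdiv σ hσmem
  obtain ⟨hσ, hσσ₀⟩ := hσmem
  have hh0 := hh.1
  have hlay := layersSeparated_of_adaptedCoordinates hα hk hσ₀ hΩ1 hS1 hSΩ hh0 hcoord hσ hσσ₀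
  have hp0 : 0 < p := by linarith
  set τ := σ ^ α with hτ
  have hτ0 : 0 < τ := by positivity
  have hτσ₀ : τ ≤ σ₀ ^ α := Real.rpow_le_rpow hσ.le (by linarith) hα.le
  have hστ : σ ^ (1 + α) = σ * τ := by rw [Real.rpow_add hσ, Real.rpow_one]
  obtain ⟨a, ha⟩ : ∃ a, a = k * σ ^ (1 + α) := ⟨_, rfl⟩
  have ha' : a = k * (σ * τ) := by rw [ha, hστ]
  have ha0 : 0 < a := by rw [ha']; positivity
  rw [← ha] at hlay
  set L := h + 3 * a with hL
  have hLa : 3 * k * (σ * τ) ≤ L := by rw [hL, ha']; linarith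
  have hL0 : 0 < L := by positivity
  have hL' : h + 3 * k * σ ^ (1 + α) = L := by rw [hL, ha]; ring
  set gn := gradNorm Ω p G (nearCylinder α k h σ) with hgn
  have hgn0 : 0 ≤ gn := ENNReal.toReal_nonneg
  set Y := σ ^ (-(2 / p)) * L ^ (2 - 1 / p) * gn with hY
  have hY0 : 0 ≤ Y := by positivity
  set N := (4 * σ ^ 2 * L) ^ (1 - 1 / p) * gn with hN
  have hNY : N * L ≤ 4 * σ ^ 2 * Y := by
    have := mul_le_mul_of_nonneg_right (rpow_one_sub_mul_le hp hσ hL0) hgn0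
    calc N * L ≤ 4 * σ ^ 2 * (σ ^ (-(2 / p)) * L ^ (2 - 1 / p)) / L * gn * L := by gcongr
      _ = 4 * σ ^ 2 * Y := by rw [hY]; field_simp
  have hN0 : 0 ≤ N := by positivity
  -- Estimates without the factor L acquire it through L ≥ 3kσ^{1+α}; this costs the extra σ^{-α} in
  -- the bounds for u_{Pτ} and ω₃.
  have hNY' : N ≤ 4 * σ * Y / (3 * k * τ) := by
    rw [le_div_iff₀ (by positivity)]
    have : σ * (N * (3 * k * τ)) ≤ σ * (4 * σ * Y) := by
      calc σ * (N * (3 * k * τ)) = N * (3 * k * (σ * τ)) := by ring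
        _ ≤ N * L := by gcongr
        _ ≤ _ := by linarith
    exact le_of_mul_le_mul_left this hσ
  obtain ⟨u2, w0, w1, w2, u0, u1⟩ := hcore Ω S hΩ.1 hS.1 hSΩ p hp u G uStar ω xStar hu hdiv α k h σ
    a N hσ hh0 ha ha0 hlay rfl
  set v := rigidVelocity uStar ω xStar
  have e1 : ∀ n : ℕ, K₀ * (N * L / σ ^ (n + 2)) ≤ K * (Y / σ ^ n) := fun n => by
    calc K₀ * (N * L / σ ^ (n + 2)) ≤ K₀ * (4 * σ ^ 2 * Y / σ ^ (n + 2)) := by gcongr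
      _ = 4 * K₀ * (Y / σ ^ n) := by rw [pow_add]; field_simp
      _ ≤ _ := by gcongr
  have e2 : ∀ n : ℕ, K₀ * (N / σ ^ (n + 1)) ≤ K * (Y / (σ ^ n * τ)) := fun n => by
    calc K₀ * (N / σ ^ (n + 1)) ≤ K₀ * (4 * σ * Y / (3 * k * τ) / σ ^ (n + 1)) := by gcongr
      _ = 4 * K₀ / (3 * k) * (Y / (σ ^ n * τ)) := by rw [pow_succ]; field_simp
      _ ≤ _ := by gcongr
  replace u2 := u2.trans (e1 1)
  replace w0 := w0.trans (e1 2)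
  replace w1 := w1.trans (e1 2)
  replace w2 := w2.trans (e2 2)
  replace u0 := u0.trans (e2 1)
  replace u1 := u1.trans (e2 1)
  rw [pow_one] at u2 u0 u1
  -- The correction 2aω has the order of the tangential bound: a/σ² = kτ²/(στ), and τ ≤ σ₀^α.
  have haw : ∀ y : ℝ, |y| ≤ K * (Y / σ ^ 2) →
      |2 * a * y| ≤ 2 * k * (σ₀ ^ α) ^ 2 * K * (Y / (σ * τ)) := by
    intro y hy
    rw [abs_mul, abs_of_pos (by positivity)]
    calc 2 * a * |y| ≤ 2 * a * (K * (Y / σ ^ 2)) := by gcongr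
      _ = 2 * k * τ ^ 2 * K * (Y / (σ * τ)) := by rw [ha']; field_simp
      _ ≤ _ := by gcongr
  have hle : ∀ Z : ℝ, 0 ≤ Z → 2 * K * Z ≤ (2 * K + 4 * k * (σ₀ ^ α) ^ 2 * K) * Z := fun Z hZ => by
    gcongr
    have : 0 ≤ 4 * k * (σ₀ ^ α) ^ 2 * K := by positivity
    linarith
  have hle' : ∀ Z : ℝ, 0 ≤ Z → K * Z ≤ (2 * K + 4 * k * (σ₀ ^ α) ^ 2 * K) * Z := fun Z hZ =>
    le_trans (by nlinarith [mul_nonneg hK.le hZ]) (hle Z hZ)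
  have p1 : σ ^ (-1 - 2 / p) = σ ^ (-(2 / p)) / σ := by
    rw [← Real.rpow_sub_one hσ.ne']; congr 1; ring
  have p2 : σ ^ (-1 - α - 2 / p) = σ ^ (-(2 / p)) / (σ * τ) := by
    rw [← hστ, ← Real.rpow_sub hσ]; congr 1; ring
  have p3 : σ ^ (-2 - 2 / p) = σ ^ (-(2 / p)) / σ ^ 2 := by
    rw [← Real.rpow_natCast σ 2, ← Real.rpow_sub hσ]; congr 1; push_cast; ring
  have p4 : σ ^ (-2 - α - 2 / p) = σ ^ (-(2 / p)) / (σ ^ 2 * τ) := by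
    rw [hτ, ← Real.rpow_natCast σ 2, ← Real.rpow_add hσ, ← Real.rpow_sub hσ]
    congr 1; push_cast; ring
  rw [hL', p1, p2, p3, p4]
  refine ⟨?_, ?_, ?_, ?_⟩
  · refine (u2.trans (hle' _ (by positivity))).trans (le_of_eq ?_)
    rw [hY]; ring
  · have t0 : |v (axisPoint h) 0| ≤
        K * (Y / (σ * τ)) + 2 * k * (σ₀ ^ α) ^ 2 * K * (Y / (σ * τ)) := by
      have := abs_sub (v (axisPoint h) 0 + 2 * a * ω 1) (2 * a * ω 1)
      rw [add_sub_cancel_right] at this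
      exact this.trans (add_le_add u0 (haw _ w1))
    have t1 : |v (axisPoint h) 1| ≤
        K * (Y / (σ * τ)) + 2 * k * (σ₀ ^ α) ^ 2 * K * (Y / (σ * τ)) := by
      have := abs_add_le (v (axisPoint h) 1 - 2 * a * ω 0) (2 * a * ω 0)
      rw [sub_add_cancel] at this
      exact this.trans (add_le_add u1 (haw _ w0))
    refine (tangNorm_le _).trans ((add_le_add t0 t1).trans (le_of_eq ?_))
    rw [hY]; ring
  · refine (tangNorm_le _).trans ((add_le_add w0 w1).trans ?_)
    refine le_trans (le_of_eq ?_) ((hle (Y / σ ^ 2) (by positivity)).trans (le_of_eq ?_))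
    · ring
    · rw [hY]; ring
  · refine (w2.trans (hle' _ (by positivity))).trans (le_of_eq ?_)
    rw [hY]; ring
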